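/- Let $n\ge 1$, let $S^{2n-1}$ be the unit sphere of $\mathbb{R}^{2n}\subset\mathbb{C}^{2n}$ with Lebesgue (surface) measure $\lambda$, and let $\varphi^t$ $(t\in\mathbb{R})$ be the linear circle action on $\mathbb{R}^{2n}$ and $\mathbb{C}^{2n}$ which maps each pair $(x_{2j-1},x_{2j})$, $1\le j\le n$, to $(\cos(2\pi t)\,x_{2j-1}+\sin(2\pi t)\,x_{2j},\ -\sin(2\pi t)\,x_{2j-1}+\cos(2\pi t)\,x_{2j})$. For $\Delta>0$ let $B_\Delta=\{z\in\mathbb{C}^{2n}:|z|\le\max(\Delta,1)\}$ (thus $\{|z|\le\Delta\}$ when $\Delta\ge1$). A homeomorphism $f$ of $S^{2n-1}$ is a $C^\omega_\Delta$ diffeomorphism if $f$ and $f^{-1}$ extend to $\mathbb{C}^{2n}$-valued maps that are holomorphic on a neighbourhood of $B_\Delta$, and an entire diffeomorphism if both extend to holomorphic maps $\mathbb{C}^{2n}\to\mathbb{C}^{2n}$; such a diffeomorphism is considered together with a choice of these extensions, denoted by the same letters, and compositions and inverses of entire diffeomorphisms are extended by composing, respectively exchanging, the chosen extensions. Put $$|f-g|_\Delta=\max\Big\{\max_{z\in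 B_\Delta}|f(z)-g(z)|,\ \max_{z\in B_\Delta}|f^{-1}(z)-g^{-1}(z)|\Big\}.$$ Then for every $t_0\in[0,1]$, $\varepsilon>0$ and $\Delta>0$ there is a $C^\omega_\Delta$ diffeomorphism $f$ of $S^{2n-1}$ that preserves $\lambda$, is uniquely ergodic (it has exactly one invariant Borel probability measure), hence minimal (every orbit is dense), and satisfies $$|f-\varphi^{t_0}|_\Delta<\varepsilon .$$ Moreover there are entire diffeomorphisms $H_k$ of $S^{2n-1}$ preserving $\lambda$ and numbers $t_k\in\mathbb{R}$ such that $|H_k\circ\varphi^{t_k}\circ H_k^{-1}-f|_\Delta\to0$ as $k\to\infty$. -/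

import Mathlib

open MeasureTheory Filter Topology
open scoped ENNReal

noncomputable section

/-- The Euclidean space `𝕜^{2n}`; the coordinates `x_{2j-1}, x_{2j}` (`1 ≤ j ≤ n`) are
indexed by the pairs `(j, 0), (j, 1)`. -/
abbrev EvenSpace (𝕜 : Type) (n : ℕ) : Type := EuclideanSpace 𝕜 (Fin n × Fin 2)

/-- The unit sphere `S^{2n-1}` in `ℝ^{2n}`. -/
abbrev OddSphere (n : ℕ) : Type := Metric.sphere (0 : EvenSpace ℝ n) 1

/-- Lebesgue (surface) measure on `S^{2n-1}`. -/
def sphereVolume (n : ℕ) : Measure (OddSphere n) :=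
  (volume : Measure (EvenSpace ℝ n)).toSphere

/-- The standard inclusion `ℝ^{2n} ⊂ ℂ^{2n}`. -/
def complexify {n : ℕ} (x : EvenSpace ℝ n) : EvenSpace ℂ n :=
  WithLp.toLp 2 fun i => ((x i : ℝ) : ℂ)

/-- The linear circle action, on `ℝ^{2n}` (`𝕜 = ℝ`) and on `ℂ^{2n}` (`𝕜 = ℂ`): each pair
`(x_{2j-1}, x_{2j})` is sent to
`(cos(2πt) x_{2j-1} + sin(2πt) x_{2j}, -sin(2πt) x_{2j-1} + cos(2πt) x_{2j})`. -/
def planeRotation (𝕜 : Type) [RCLike 𝕜] {n : ℕ} (t : ℝ) (x : EvenSpace 𝕜 n) : EvenSpace 𝕜 n :=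
  WithLp.toLp 2 fun i =>
    if i.2 = 0 then
      (Real.cos (2 * Real.pi * t) : 𝕜) * x (i.1, 0) + (Real.sin (2 * Real.pi * t) : 𝕜) * x (i.1, 1)
    else
      -(Real.sin (2 * Real.pi * t) : 𝕜) * x (i.1, 0) + (Real.cos (2 * Real.pi * t) : 𝕜) * x (i.1, 1)

/-- `F` is holomorphic on an open neighbourhood of `K`. -/
def HolomorphicNear {n : ℕ} (F : EvenSpace ℂ n → EvenSpace ℂ n) (K : Set (EvenSpace ℂ n)) : Prop :=
  ∃ U : Set (EvenSpace ℂ n), IsOpen U ∧ K ⊆ U ∧ DifferentiableOn ℂ F U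

/-- A homeomorphism of `S^{2n-1}` such that it and its inverse are restrictions of maps that are
holomorphic near `K ⊆ ℂ^{2n}`, together with these extensions. (Used for `K` containing the
sphere, where it is therefore a real-analytic diffeomorphism. The extensions are part
of the data because they are not determined by the values on the sphere; the distance below
depends on them.) -/
structure HolDiffeo (n : ℕ) (K : Set (EvenSpace ℂ n)) where
  /-- the map of the sphere -/
  toHomeo : OddSphere n ≃ₜ OddSphere n
  /-- the holomorphic extension of the map -/
  ext : EvenSpace ℂ n → EvenSpace ℂ n
  /-- the holomorphic extension of the inverse -/
  extInv : EvenSpace ℂ n → EvenSpace ℂ n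
  holo_ext : HolomorphicNear ext K
  holo_extInv : HolomorphicNear extInv K
  ext_apply : ∀ x : OddSphere n,
    ext (complexify (x : EvenSpace ℝ n)) = complexify (toHomeo x : EvenSpace ℝ n)
  extInv_apply : ∀ x : OddSphere n,
    extInv (complexify (x : EvenSpace ℝ n)) = complexify (toHomeo.symm x : EvenSpace ℝ n)

/-- Entire diffeomorphisms of `S^{2n-1}`. -/
abbrev EntDiffeo (n : ℕ) : Type := HolDiffeo n Set.univ

/-- The closed ball `B_Δ` of `ℂ^{2n}` on which extensions live; for `Δ < 1`, where this ball would
not contain the sphere, it is replaced by `B_1`. -/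
def extBall (n : ℕ) (Δ : ℝ) : Set (EvenSpace ℂ n) := Metric.closedBall 0 (max Δ 1)

/-- The distance `max (sup_K |f - g|) (sup_K |f⁻¹ - g⁻¹|)`. -/
def holDist {n : ℕ} (K : Set (EvenSpace ℂ n)) {L M : Set (EvenSpace ℂ n)}
    (f : HolDiffeo n L) (g : HolDiffeo n M) : ℝ≥0∞ :=
  max (⨆ z ∈ K, edist (f.ext z) (g.ext z)) (⨆ z ∈ K, edist (f.extInv z) (g.extInv z))

/-- Preservation of the Lebesgue measure of the sphere. -/
def HolDiffeo.VolumePreserving {n : ℕ} {K : Set (EvenSpace ℂ n)} (f : HolDiffeo n K) : Prop :=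
  MeasurePreserving f.toHomeo (sphereVolume n) (sphereVolume n)

/-- Exactly one invariant Borel probability measure. -/
def UniquelyErgodic {X : Type*} [MeasurableSpace X] (f : X → X) : Prop :=
  ∃! μ : Measure X, IsProbabilityMeasure μ ∧ MeasurePreserving f μ μ

/-- Every orbit is dense. -/
def MinimalHomeo {X : Type*} [TopologicalSpace X] (f : X ≃ₜ X) : Prop :=
  ∀ x : X, Dense (Set.range fun k : ℤ => (f ^ k) x)

theorem HolomorphicNear.differentiable {n : ℕ} {F : EvenSpace ℂ n → EvenSpace ℂ n}
    (h : HolomorphicNear F Set.univ) : Differentiable ℂ F := by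
  obtain ⟨U, -, hU, hF⟩ := h
  rw [Set.univ_subset_iff.mp hU] at hF
  exact differentiableOn_univ.mp hF

theorem Differentiable.holomorphicNear {n : ℕ} {F : EvenSpace ℂ n → EvenSpace ℂ n}
    (h : Differentiable ℂ F) (K : Set (EvenSpace ℂ n)) : HolomorphicNear F K :=
  ⟨Set.univ, isOpen_univ, Set.subset_univ K, h.differentiableOn⟩

/-- Composition of entire diffeomorphisms. -/
def EntDiffeo.comp {n : ℕ} (f g : EntDiffeo n) : EntDiffeo n where
  toHomeo := g.toHomeo.trans f.toHomeo
  ext := f.ext ∘ g.ext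
  extInv := g.extInv ∘ f.extInv
  holo_ext := (f.holo_ext.differentiable.comp g.holo_ext.differentiable).holomorphicNear _
  holo_extInv := (g.holo_extInv.differentiable.comp f.holo_extInv.differentiable).holomorphicNear _
  ext_apply x := by simp [g.ext_apply, f.ext_apply]
  extInv_apply x := by simp [g.extInv_apply, f.extInv_apply]

/-- The inverse of an entire diffeomorphism. -/
def EntDiffeo.inv {n : ℕ} (f : EntDiffeo n) : EntDiffeo n where
  toHomeo := f.toHomeo.symm
  ext := f.extInv
  extInv := f.ext
  holo_ext := f.holo_extInv
  holo_extInv := f.holo_ext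
  ext_apply x := f.extInv_apply x
  extInv_apply x := f.ext_apply x

theorem norm_planeRotation {n : ℕ} (t : ℝ) (x : EvenSpace ℝ n) : ‖planeRotation ℝ t x‖ = ‖x‖ := by
  rw [EuclideanSpace.norm_eq, EuclideanSpace.norm_eq]
  congr 1
  rw [Fintype.sum_prod_type, Fintype.sum_prod_type]
  refine Finset.sum_congr rfl fun j _ => ?_
  simp only [Fin.sum_univ_two, Real.norm_eq_abs, sq_abs, planeRotation]
  simp
  linear_combination (x (j, 0) ^ 2 + x (j, 1) ^ 2) * Real.sin_sq_add_cos_sq (2 * Real.pi * t)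

theorem planeRotation_neg_planeRotation {n : ℕ} (t : ℝ) (x : EvenSpace ℝ n) :
    planeRotation ℝ (-t) (planeRotation ℝ t x) = x := by
  have h := Real.sin_sq_add_cos_sq (2 * Real.pi * t)
  ext ⟨j, k⟩
  fin_cases k
  · simp [planeRotation]
    linear_combination x (j, 0) * h
  · simp [planeRotation]
    linear_combination x (j, 1) * h

theorem continuous_planeRotation {n : ℕ} (t : ℝ) :
    Continuous (planeRotation ℝ t : EvenSpace ℝ n → EvenSpace ℝ n) := by
  unfold planeRotation
  refine (PiLp.continuous_toLp 2 _).comp (continuous_pi fun i => ?_)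
  split_ifs <;> fun_prop

theorem differentiable_planeRotation {n : ℕ} (t : ℝ) :
    Differentiable ℂ (planeRotation ℂ t : EvenSpace ℂ n → EvenSpace ℂ n) := by
  rw [differentiable_euclidean]
  intro i
  simp only [planeRotation]
  split_ifs <;> fun_prop

theorem planeRotation_complexify {n : ℕ} (t : ℝ) (x : EvenSpace ℝ n) :
    planeRotation ℂ t (complexify x) = complexify (planeRotation ℝ t x) := by
  ext i
  simp only [planeRotation, complexify]
  split_ifs <;> simp

theorem mem_sphere_planeRotation {n : ℕ} (t : ℝ) (x : OddSphere n) :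
    planeRotation ℝ t (x : EvenSpace ℝ n) ∈ Metric.sphere (0 : EvenSpace ℝ n) 1 := by
  have h := x.2
  rw [mem_sphere_zero_iff_norm] at h ⊢
  rw [norm_planeRotation, h]

/-- The rotation `φ^t` as a map of the sphere. -/
def sphereRotation {n : ℕ} (t : ℝ) (x : OddSphere n) : OddSphere n :=
  ⟨planeRotation ℝ t (x : EvenSpace ℝ n), mem_sphere_planeRotation t x⟩

theorem sphereRotation_neg {n : ℕ} (t : ℝ) (x : OddSphere n) :
    sphereRotation (-t) (sphereRotation t x) = x :=
  Subtype.ext (planeRotation_neg_planeRotation t (x : EvenSpace ℝ n))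

theorem continuous_sphereRotation {n : ℕ} (t : ℝ) :
    Continuous (sphereRotation t : OddSphere n → OddSphere n) :=
  ((continuous_planeRotation t).comp continuous_subtype_val).subtype_mk _

/-- The rotation `φ^t` as a homeomorphism of the sphere, with inverse `φ^{-t}`. -/
def sphereRotationHomeo (n : ℕ) (t : ℝ) : OddSphere n ≃ₜ OddSphere n where
  toFun := sphereRotation t
  invFun := sphereRotation (-t)
  left_inv := sphereRotation_neg t
  right_inv x := by
    have h := sphereRotation_neg (-t) x
    rwa [neg_neg] at h
  continuous_toFun := continuous_sphereRotation t
  continuous_invFun := continuous_sphereRotation (-t)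

/-- The circle action `φ^t` on `S^{2n-1}`, with its linear extension to `ℂ^{2n}`. -/
def circleFlow (n : ℕ) (t : ℝ) : EntDiffeo n where
  toHomeo := sphereRotationHomeo n t
  ext := planeRotation ℂ t
  extInv := planeRotation ℂ (-t)
  holo_ext := (differentiable_planeRotation t).holomorphicNear _
  holo_extInv := (differentiable_planeRotation (-t)).holomorphicNear _
  ext_apply x := planeRotation_complexify t (x : EvenSpace ℝ n)
  extInv_apply x := planeRotation_complexify (-t) (x : EvenSpace ℝ n)

end

/-! The method is approximation by conjugation (Anosov–Katok) with entire conjugacies. The map `f`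
is a limit of conjugates `H ∘ φ^{p/q} ∘ H⁻¹`. At each stage `H` is replaced by `H ∘ h`, where `h`
commutes with the rotations by multiples of `1/q`. The conjugate of `φ^{p/q}` is unchanged by this,
even as an entire map. Hence, once `h` is fixed, replacing `p/q` by `p/q + 1/(qr)` with `r` large
moves the diffeomorphism arbitrarily little on a compact set of `ℂ^{2n}` (`exists_conjFlow_step`).
The `q`-th power of the new map is conjugate to rotation by `1/r`, so its Birkhoff means over `r`
steps are Riemann sums for averages over the curves `H(h(φ^t x))`. It remains to choose `h` so that
these averages of a given observable hardly depend on `x`.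

For a unit vector `u`, let `T_u` fix the plane of `u` and its quarter turn and act as `φ` on the
orthogonal complement; it commutes with `φ`. With `w` the complex coordinate on that plane, the
shear `x ↦ T_u(M re(w^q)) x` is volume preserving and extends to an entire map, whose inverse has
the same form with `-M`, because the phase is a `T_u`-invariant polynomial. Along a `φ`-orbit the
phase oscillates fast and, where `w` is not small, with huge amplitude, so modulo one it
equidistributes. Averaging `F` over the sheared orbit therefore amounts to averaging it over `φ` and
then over `T_u` (`PeriodicFlow.exists_shear_avg`). Where `w` vanishes, `T_u` and `φ` agree, and the
second average changes nothing.

Composing shears realises successive averages over several `T_u`. As the `T_u` and `φ` are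
transitive together, a compactness argument makes some finite sequence of averages nearly constant
(`PeriodicFlow.exists_avgList_near_const`).

Nearly constant Birkhoff means survive small uniform perturbations, so with rapidly shrinking
tolerances the limit inherits them for every continuous observable. This yields unique ergodicity
and, since the volume has full support, minimality. Uniform convergence on a slightly larger ball
keeps the limit and its inverse holomorphic. -/

noncomputable section

/-! ### Equidistribution of large circles modulo one -/

/-- Equidistribution modulo one of `R cos (2πs)` away from the critical points. -/
theorem exists_bound_integral_comp_cos {δ : ℝ} (hδ : 0 < δ) (hδ' : δ < 1 / 4) :
    ∃ C : ℝ, 0 ≤ C ∧ ∀ (k K : ℝ → ℝ) (B R : ℝ), Continuous k → (∀ x, HasDerivAt K (k x) x) →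
      (∀ x, |K x| ≤ B) → 0 < R →
      |∫ s in δ..(1 / 2 - δ), k (R * Real.cos (2 * Real.pi * s))| ≤ C * B / R := by
  have hle : δ ≤ 1 / 2 - δ := by linarith
  have hpi := Real.pi_pos
  have hsin : ∀ s ∈ Set.Icc δ (1 / 2 - δ), 0 < Real.sin (2 * Real.pi * s) := fun s hs =>
    Real.sin_pos_of_pos_of_lt_pi (by have := hδ.trans_le hs.1; positivity)
      (by have := hs.2; nlinarith)
  obtain ⟨σ, hσ, hσs⟩ := isCompact_Icc.exists_forall_le' (a := (0 : ℝ))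
    (f := fun s => Real.sin (2 * Real.pi * s)) (by fun_prop) hsin
  -- The two boundary terms of the integration by parts contribute `B / (2πσR)` each, the remaining
  -- integral at most `B / (σ²R)`.
  refine ⟨2 * (1 / (2 * Real.pi * σ)) + 1 / σ ^ 2, by positivity, ?_⟩
  intro k K B R hk hK hKB hR
  have hB : 0 ≤ B := (abs_nonneg _).trans (hKB 0)
  -- `v` is the reciprocal of the derivative of the phase `R cos (2πs)`, so the integrand is `v`
  -- times the derivative of `K` along the phase.
  set v : ℝ → ℝ := fun s => -(1 / (2 * Real.pi * R)) * (Real.sin (2 * Real.pi * s))⁻¹ with hv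
  set v' : ℝ → ℝ := fun s => -(1 / (2 * Real.pi * R)) *
    (-(Real.cos (2 * Real.pi * s) * (2 * Real.pi)) / Real.sin (2 * Real.pi * s) ^ 2) with hv'
  have hlin : ∀ s : ℝ, HasDerivAt (fun s => 2 * Real.pi * s) (2 * Real.pi) s := fun s => by
    simpa using (hasDerivAt_id s).const_mul (2 * Real.pi)
  have hdv : ∀ s ∈ Set.uIcc δ (1 / 2 - δ), HasDerivAt v (v' s) s := by
    intro s hs
    rw [Set.uIcc_of_le hle] at hs
    exact ((((Real.hasDerivAt_sin _).comp s (hlin s)).inv (hsin s hs).ne').const_mul _)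
  have hdu : ∀ s ∈ Set.uIcc δ (1 / 2 - δ),
      HasDerivAt (fun s => K (R * Real.cos (2 * Real.pi * s)))
        (k (R * Real.cos (2 * Real.pi * s)) * (R * (-Real.sin (2 * Real.pi * s) * (2 * Real.pi)))) s :=
    fun s _ => (hK _).comp s (((Real.hasDerivAt_cos _).comp s (hlin s)).const_mul R)
  have hcv' : ContinuousOn v' (Set.uIcc δ (1 / 2 - δ)) := by
    rw [Set.uIcc_of_le hle]
    refine continuousOn_const.mul (ContinuousOn.div (by fun_prop) (by fun_prop) ?_)
    intro s hs
    exact pow_ne_zero _ (hsin s hs).ne'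
  have hparts := intervalIntegral.integral_deriv_mul_eq_sub hdu hdv
    (Continuous.intervalIntegrable (by fun_prop) _ _) hcv'.intervalIntegrable
  have heq : ∀ s ∈ Set.uIcc δ (1 / 2 - δ),
      k (R * Real.cos (2 * Real.pi * s)) * (R * (-Real.sin (2 * Real.pi * s) * (2 * Real.pi))) * v s +
        K (R * Real.cos (2 * Real.pi * s)) * v' s =
      k (R * Real.cos (2 * Real.pi * s)) + K (R * Real.cos (2 * Real.pi * s)) * v' s := by
    intro s hs
    rw [Set.uIcc_of_le hle] at hs
    have := (hsin s hs).ne'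
    simp only [hv]
    field_simp
  rw [intervalIntegral.integral_congr heq] at hparts
  have hcK : Continuous K := continuous_iff_continuousAt.2 fun x => (hK x).continuousAt
  have hint : IntervalIntegrable (fun s => K (R * Real.cos (2 * Real.pi * s)) * v' s) volume
      δ (1 / 2 - δ) :=
    ContinuousOn.intervalIntegrable ((by fun_prop : Continuous fun s =>
      K (R * Real.cos (2 * Real.pi * s))).continuousOn.mul hcv')
  rw [intervalIntegral.integral_add (Continuous.intervalIntegrable (by fun_prop) _ _) hint] at hparts
  have hvb : ∀ s ∈ Set.Icc δ (1 / 2 - δ), |v s| ≤ 1 / (2 * Real.pi * σ) / R := by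
    intro s hs
    have h1 := hσs s hs
    simp only [hv, abs_mul, abs_neg, abs_inv]
    rw [abs_of_pos (by positivity), abs_of_pos (hσ.trans_le h1)]
    calc 1 / (2 * Real.pi * R) * (Real.sin (2 * Real.pi * s))⁻¹
        ≤ 1 / (2 * Real.pi * R) * σ⁻¹ := by gcongr
      _ = _ := by field_simp
  have hvb' : ∀ s ∈ Set.Icc δ (1 / 2 - δ), |v' s| ≤ 1 / σ ^ 2 / R := by
    intro s hs
    have h1 := hσs s hs
    have h0 := hsin s hs
    simp only [hv', abs_mul, abs_neg, abs_div, abs_pow]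
    rw [abs_of_pos hR, abs_of_pos h0, abs_of_pos hpi, abs_one, abs_two]
    calc 1 / (2 * Real.pi * R) * (|Real.cos (2 * Real.pi * s)| * (2 * Real.pi) /
          Real.sin (2 * Real.pi * s) ^ 2)
        ≤ 1 / (2 * Real.pi * R) * (1 * (2 * Real.pi) / σ ^ 2) := by
          gcongr
          exact Real.abs_cos_le_one _
      _ = _ := by field_simp
  have hI : |∫ s in δ..(1 / 2 - δ), K (R * Real.cos (2 * Real.pi * s)) * v' s| ≤
      B * (1 / σ ^ 2 / R) := by
    have := intervalIntegral.norm_integral_le_of_norm_le_const (a := δ) (b := 1 / 2 - δ)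
      (f := fun s => K (R * Real.cos (2 * Real.pi * s)) * v' s) (C := B * (1 / σ ^ 2 / R)) (by
        intro s hs
        rw [Set.uIoc_of_le hle] at hs
        rw [Real.norm_eq_abs, abs_mul]
        exact mul_le_mul (hKB _) (hvb' s ⟨hs.1.le, hs.2⟩) (abs_nonneg _) hB)
    refine this.trans (mul_le_of_le_one_right (by positivity) ?_)
    rw [abs_of_nonneg (by linarith)]
    linarith
  have e1 := mul_le_mul (hKB (R * Real.cos (2 * Real.pi * (1 / 2 - δ))))
    (hvb (1 / 2 - δ) ⟨hle, le_rfl⟩) (abs_nonneg _) hB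
  have e2 := mul_le_mul (hKB (R * Real.cos (2 * Real.pi * δ)))
    (hvb δ ⟨le_rfl, hle⟩) (abs_nonneg _) hB
  rw [← abs_mul] at e1 e2
  have : (2 * (1 / (2 * Real.pi * σ)) + 1 / σ ^ 2) * B / R =
    B * (1 / (2 * Real.pi * σ) / R) + B * (1 / (2 * Real.pi * σ) / R) + B * (1 / σ ^ 2 / R) := by
    field_simp
    ring
  rw [this, eq_sub_of_add_eq hparts]
  exact (abs_sub _ _).trans (add_le_add ((abs_sub _ _).trans (add_le_add e1 e2)) hI)

/-- Large circles project to `ℝ / ℤ` in an equidistributed way, uniformly over bounded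
observables. -/
theorem exists_equidistribution_re_circle (B : ℝ) {ε : ℝ} (hε : 0 < ε) :
    ∃ R₀ : ℝ, 0 < R₀ ∧ ∀ (k : ℝ → ℝ) (c : ℂ), Continuous k → Function.Periodic k 1 →
      (∀ x, |k x| ≤ B) → R₀ ≤ ‖c‖ →
      |(∫ s in (0 : ℝ)..1, k (c * Complex.exp (2 * Real.pi * s * Complex.I)).re) -
        ∫ s in (0 : ℝ)..1, k s| ≤ ε := by
  wlog hB : 0 < B generalizing B
  · obtain ⟨R₀, h0, h⟩ := this 1 one_pos
    exact ⟨R₀, h0, fun k c hk hp hb => h k c hk hp fun x => (hb x).trans (by linarith)⟩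
  -- On each half period the two pieces of length `δ` next to the critical points cost at most `4Bδ
  -- ≤ ε/4`; the main part is given another `ε/4`.
  set δ : ℝ := min (1 / 8) (ε / (16 * B)) with hδdef
  have hδ : 0 < δ := by positivity
  have hδ4 : δ < 1 / 4 := (min_le_left _ _).trans_lt (by norm_num)
  have hδε : δ * (16 * B) ≤ ε := by
    have : δ ≤ ε / (16 * B) := min_le_right _ _
    rwa [le_div_iff₀ (by positivity)] at this
  obtain ⟨C, hC0, hC⟩ := exists_bound_integral_comp_cos hδ hδ4
  refine ⟨8 * (C + 1) * B / ε, by positivity, ?_⟩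
  intro k c hk hper hkB hc
  have hR : 0 < ‖c‖ := lt_of_lt_of_le (by positivity) hc
  set R := ‖c‖ with hRdef
  set m := ∫ s in (0 : ℝ)..1, k s with hm
  have hmB : |m| ≤ B := by
    have := intervalIntegral.norm_integral_le_of_norm_le_const (a := 0) (b := 1) (f := k) (C := B)
      (fun s _ => hkB s)
    simpa using this
  set k0 : ℝ → ℝ := fun x => k x - m with hk0
  have hk0c : Continuous k0 := by fun_prop
  have hk0B : ∀ x, |k0 x| ≤ 2 * B := fun x => (abs_sub _ _).trans (by linarith [hkB x])
  have hk0p : Function.Periodic k0 1 := fun x => by simp [hk0, hper x]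
  have hk0i : ∫ s in (0 : ℝ)..1, k0 s = 0 := by
    simp only [hk0]
    rw [intervalIntegral.integral_sub (hk.intervalIntegrable _ _) (by simp)]
    simp [hm]
  set K : ℝ → ℝ := fun x => ∫ s in (0 : ℝ)..x, k0 s with hK
  have hKd : ∀ x, HasDerivAt K (k0 x) x := fun x =>
    intervalIntegral.integral_hasDerivAt_right (hk0c.intervalIntegrable _ _)
      (hk0c.stronglyMeasurableAtFilter _ _) hk0c.continuousAt
  have hKp : Function.Periodic K 1 := by
    intro x
    simp only [hK]
    rw [← intervalIntegral.integral_add_adjacent_intervals (hk0c.intervalIntegrable 0 x)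
      (hk0c.intervalIntegrable x (x + 1)), hk0p.intervalIntegral_add_eq x 0]
    simp [hk0i]
  have hKB : ∀ x, |K x| ≤ 2 * B := by
    intro x
    obtain ⟨y, hy, hxy⟩ := hKp.exists_mem_Ico₀ one_pos x
    rw [hxy]
    have := intervalIntegral.norm_integral_le_of_norm_le_const (a := 0) (b := y) (f := k0)
      (C := 2 * B) (fun s _ => hk0B s)
    refine this.trans (mul_le_of_le_one_right (by positivity) ?_)
    rw [sub_zero, abs_of_nonneg hy.1]
    exact hy.2.le
  have hgc : Continuous fun s : ℝ => k0 (R * Real.cos (2 * Real.pi * s)) := by fun_prop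
  have hgp : Function.Periodic (fun s : ℝ => k0 (R * Real.cos (2 * Real.pi * s))) 1 := by
    intro s
    simp only [mul_add, mul_one, Real.cos_add_two_pi]
  have hmain : (∫ s in (0 : ℝ)..1, k (c * Complex.exp (2 * Real.pi * s * Complex.I)).re) - m =
      ∫ s in (0 : ℝ)..1, k0 (R * Real.cos (2 * Real.pi * s)) := by
    -- The argument of `c` is only a time shift, which integration over a period does not see.
    have e : ∀ s : ℝ, (c * Complex.exp (2 * Real.pi * s * Complex.I)).re =
        R * Real.cos (2 * Real.pi * (s + c.arg / (2 * Real.pi))) := by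
      intro s
      have h1 : c * Complex.exp (2 * Real.pi * s * Complex.I) =
          (R : ℂ) * Complex.exp ((2 * Real.pi * (s + c.arg / (2 * Real.pi)) : ℝ) * Complex.I) := by
        conv_lhs => rw [← Complex.norm_mul_exp_arg_mul_I c]
        rw [mul_assoc, ← Complex.exp_add]
        congr 2
        have := Real.pi_ne_zero
        rw [show 2 * Real.pi * (s + c.arg / (2 * Real.pi)) = c.arg + 2 * Real.pi * s by
          field_simp; ring]
        push_cast
        ring
      rw [h1, Complex.re_ofReal_mul, Complex.exp_ofReal_mul_I_re]
    simp only [e]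
    rw [intervalIntegral.integral_comp_add_right
      (fun s => k (R * Real.cos (2 * Real.pi * s))) (c.arg / (2 * Real.pi)), zero_add,
      add_comm (1 : ℝ)]
    have : Function.Periodic (fun s : ℝ => k (R * Real.cos (2 * Real.pi * s))) 1 := by
      intro s
      simp only [mul_add, mul_one, Real.cos_add_two_pi]
    rw [this.intervalIntegral_add_eq _ 0, zero_add]
    simp only [hk0]
    rw [intervalIntegral.integral_sub (Continuous.intervalIntegrable (by fun_prop) _ _) (by simp)]
    simp
  rw [hmain]
  set g : ℝ → ℝ := fun s => k0 (R * Real.cos (2 * Real.pi * s)) with hg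
  have hgi : ∀ a b, IntervalIntegrable g volume a b := fun a b => hgc.intervalIntegrable a b
  have hsym : ∫ s in (1 / 2 : ℝ)..1, g s = ∫ s in (0 : ℝ)..(1 / 2), g s := by
    have : ∀ s, g (1 - s) = g s := by
      intro s
      simp only [hg]
      rw [mul_sub, mul_one, Real.cos_two_pi_sub]
    rw [← intervalIntegral.integral_congr (fun s _ => this s),
      intervalIntegral.integral_comp_sub_left g 1]
    norm_num
  have hhalf : |∫ s in (0 : ℝ)..(1 / 2), g s| ≤ ε / 2 := by
    rw [← intervalIntegral.integral_add_adjacent_intervals (hgi 0 δ) (hgi δ (1 / 2)),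
      ← intervalIntegral.integral_add_adjacent_intervals (hgi δ (1 / 2 - δ)) (hgi _ (1 / 2))]
    have b1 := intervalIntegral.norm_integral_le_of_norm_le_const (a := 0) (b := δ) (f := g)
      (C := 2 * B) (fun s _ => hk0B _)
    have b2 := intervalIntegral.norm_integral_le_of_norm_le_const (a := 1 / 2 - δ) (b := 1 / 2)
      (f := g) (C := 2 * B) (fun s _ => hk0B _)
    have b3 := hC k0 K (2 * B) R hk0c hKd hKB hR
    have b4 : C * (2 * B) / R ≤ ε / 4 := by
      rw [div_le_iff₀ hR]
      rw [div_le_iff₀ hε] at hc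
      nlinarith
    rw [Real.norm_eq_abs] at b1 b2
    rw [show (1 / 2 - (1 / 2 - δ) : ℝ) = δ by ring, abs_of_pos hδ] at b2
    rw [sub_zero, abs_of_pos hδ] at b1
    calc _ ≤ |∫ s in (0 : ℝ)..δ, g s| + (|∫ s in δ..(1 / 2 - δ), g s| +
          |∫ s in (1 / 2 - δ)..(1 / 2), g s|) :=
          (abs_add_le _ _).trans (add_le_add le_rfl (abs_add_le _ _))
      _ ≤ 2 * B * δ + (ε / 4 + 2 * B * δ) := add_le_add b1 (add_le_add (b3.trans b4) b2)
      _ ≤ ε / 2 := by nlinarith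
  rw [← intervalIntegral.integral_add_adjacent_intervals (hgi 0 (1 / 2)) (hgi (1 / 2) 1), hsym]
  rw [abs_le] at hhalf ⊢
  constructor <;> linarith [hhalf.1, hhalf.2]

/-! ### Periodic flows and orbit averages -/

/-- A continuous action of `ℝ / ℤ`. -/
structure PeriodicFlow (X : Type*) [TopologicalSpace X] where
  /-- the time-`t` maps -/
  toFun : ℝ → X → X
  continuous_uncurry : Continuous (Function.uncurry toFun)
  map_add : ∀ s t x, toFun (s + t) x = toFun s (toFun t x)
  map_one : ∀ x, toFun 1 x = x

namespace PeriodicFlow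

section Basic

variable {X : Type*} [TopologicalSpace X]

instance : CoeFun (PeriodicFlow X) fun _ => ℝ → X → X := ⟨PeriodicFlow.toFun⟩

theorem continuous_comp (τ : PeriodicFlow X) {Y : Type*} [TopologicalSpace Y] {f : Y → ℝ}
    {g : Y → X} (hf : Continuous f) (hg : Continuous g) : Continuous fun y => τ (f y) (g y) :=
  τ.continuous_uncurry.comp (hf.prodMk hg)

theorem map_zero (τ : PeriodicFlow X) (x : X) : τ 0 x = x := by
  have h := τ.map_add 0 1 x
  rw [τ.map_one, zero_add, τ.map_one] at h
  exact h.symm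

theorem periodic (τ : PeriodicFlow X) (x : X) : Function.Periodic (fun s => τ s x) 1 := fun s => by
  simp only [τ.map_add, τ.map_one]

/-- Average of an observable along the orbits. -/
def avg (τ : PeriodicFlow X) (F : C(X, ℝ)) : C(X, ℝ) where
  toFun x := ∫ s in (0 : ℝ)..1, F (τ s x)
  continuous_toFun := by
    refine intervalIntegral.continuous_parametric_intervalIntegral_of_continuous' ?_ _ _
    exact F.continuous.comp (τ.continuous_comp continuous_snd continuous_fst)

theorem continuous_orbit (τ : PeriodicFlow X) (F : C(X, ℝ)) (x : X) :
    Continuous fun s => F (τ s x) :=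
  F.continuous.comp (τ.continuous_comp continuous_id continuous_const)

theorem periodic_orbit (τ : PeriodicFlow X) (F : C(X, ℝ)) (x : X) :
    Function.Periodic (fun s => F (τ s x)) 1 := (τ.periodic x).comp F

theorem avg_apply (τ : PeriodicFlow X) (F : C(X, ℝ)) (x : X) :
    τ.avg F x = ∫ s in (0 : ℝ)..1, F (τ s x) := rfl

theorem avg_self_apply (τ : PeriodicFlow X) (F : C(X, ℝ)) (t : ℝ) (x : X) :
    τ.avg F (τ t x) = τ.avg F x := by
  simp only [avg_apply, ← τ.map_add]
  rw [intervalIntegral.integral_comp_add_right (fun s => F (τ s x)), zero_add, add_comm,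
    (τ.periodic_orbit F x).intervalIntegral_add_eq _ 0, zero_add]

theorem avg_comm_apply (τ σ : PeriodicFlow X) (h : ∀ s t x, τ s (σ t x) = σ t (τ s x))
    (F : C(X, ℝ)) (hF : ∀ t x, F (σ t x) = F x) (t : ℝ) (x : X) :
    τ.avg F (σ t x) = τ.avg F x := by
  simp only [avg_apply, h, hF]

end Basic

end PeriodicFlow

theorem abs_integral_sub_integral_le {f g : ℝ → ℝ} {ε : ℝ} (hf : Continuous f) (hg : Continuous g)
    (h : ∀ s ∈ Set.Icc (0 : ℝ) 1, |f s - g s| ≤ ε) :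
    |(∫ s in (0 : ℝ)..1, f s) - ∫ s in (0 : ℝ)..1, g s| ≤ ε := by
  rw [← intervalIntegral.integral_sub (hf.intervalIntegrable _ _) (hg.intervalIntegrable _ _)]
  have := intervalIntegral.norm_integral_le_of_norm_le_const (a := 0) (b := 1)
    (f := fun s => f s - g s) (C := ε) (fun s hs => by
      rw [Set.uIoc_of_le zero_le_one] at hs
      exact h s ⟨hs.1.le, hs.2⟩)
  simpa using this

theorem integral_integral_swap_of_continuous {f : ℝ → ℝ → ℝ}
    (hf : Continuous fun p : ℝ × ℝ => f p.1 p.2) (a b c d : ℝ) :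
    (∫ s in a..b, ∫ t in c..d, f s t) = ∫ t in c..d, ∫ s in a..b, f s t := by
  exact intervalIntegral_intervalIntegral_swap ((hf.continuousOn.integrableOn_compact
    (isCompact_uIcc.prod isCompact_uIcc)).mono_set
    (Set.prod_mono Set.uIoc_subset_uIcc Set.uIoc_subset_uIcc))

namespace PeriodicFlow

section Bounds

variable {X : Type*} [TopologicalSpace X]

theorem abs_avg_sub_avg_le (τ : PeriodicFlow X) {F G : C(X, ℝ)} {ε : ℝ}
    (h : ∀ x, |F x - G x| ≤ ε) (x : X) : |τ.avg F x - τ.avg G x| ≤ ε :=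
  abs_integral_sub_integral_le (τ.continuous_orbit F x) (τ.continuous_orbit G x) fun _ _ => h _

theorem avg_add_const (τ : PeriodicFlow X) (F : C(X, ℝ)) (b : ℝ) :
    τ.avg (F + ContinuousMap.const X b) = τ.avg F + ContinuousMap.const X b := by
  ext x
  simp only [avg_apply, ContinuousMap.add_apply, ContinuousMap.const_apply]
  rw [intervalIntegral.integral_add ((τ.continuous_orbit F x).intervalIntegrable _ _) (by simp)]
  simp

theorem avg_le (τ : PeriodicFlow X) {F : C(X, ℝ)} {m : ℝ} (h : ∀ x, F x ≤ m) (x : X) :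
    τ.avg F x ≤ m := by
  have := intervalIntegral.integral_mono (a := 0) (b := 1) zero_le_one
    ((τ.continuous_orbit F x).intervalIntegrable (μ := volume) _ _)
    (_root_.continuous_const.intervalIntegrable _ _) (fun s => h (τ s x))
  simpa [avg_apply] using this

theorem avg_nonneg (τ : PeriodicFlow X) {F : C(X, ℝ)} (h : ∀ x, 0 ≤ F x) (x : X) :
    0 ≤ τ.avg F x :=
  intervalIntegral.integral_nonneg zero_le_one fun _ _ => h _

theorem avg_lt (τ : PeriodicFlow X) {F : C(X, ℝ)} {m : ℝ} (h : ∀ x, F x ≤ m) {x : X} {s : ℝ}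
    (hs : F (τ s x) < m) : τ.avg F x < m := by
  obtain ⟨y, hy, hxy⟩ := (τ.periodic_orbit F x).exists_mem_Ico₀ one_pos s
  have hc : Continuous fun s => m - F (τ s x) := continuous_const.sub (τ.continuous_orbit F x)
  have hpos := intervalIntegral.integral_pos (a := 0) (b := 1) one_pos hc.continuousOn
    (fun s _ => sub_nonneg.2 (h _)) ⟨y, ⟨hy.1, hy.2.le⟩, sub_pos.2 (lt_of_eq_of_lt hxy.symm hs)⟩
  rw [intervalIntegral.integral_sub (by simp) ((τ.continuous_orbit F x).intervalIntegrable _ _)]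
    at hpos
  simpa [avg_apply] using hpos

/-- Successive averages along several flows. -/
def avgList {ι : Type*} (T : ι → PeriodicFlow X) (L : List ι) (F : C(X, ℝ)) : C(X, ℝ) :=
  L.foldr (fun u G => (T u).avg G) F

theorem avgList_add_const {ι : Type*} (T : ι → PeriodicFlow X) (L : List ι) (F : C(X, ℝ)) (b : ℝ) :
    avgList T L (F + ContinuousMap.const X b) = avgList T L F + ContinuousMap.const X b := by
  induction L with
  | nil => rfl
  | cons u L ih =>
    simp only [avgList, List.foldr_cons] at ih ⊢
    rw [ih, avg_add_const]

end Bounds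

/-! ### Averaging by shears and reduction to nearly constant averages -/

section Compact

variable {X : Type*} [MetricSpace X] [CompactSpace X]

theorem exists_forall_small_time (τ : PeriodicFlow X) (F : C(X, ℝ)) {ε : ℝ} (hε : 0 < ε) :
    ∃ δ > 0, ∀ s ∈ Set.Icc (0 : ℝ) δ, ∀ x, |F (τ s x) - F x| ≤ ε := by
  have hc : Continuous fun p : X × ℝ => |F (τ p.2 p.1) - F p.1| := by
    have := F.continuous.comp (τ.continuous_comp (Y := X × ℝ) continuous_snd continuous_fst)
    exact (this.sub (F.continuous.comp continuous_fst)).abs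
  have h : ∀ᶠ s in 𝓝 (0 : ℝ), ∀ x ∈ (Set.univ : Set X), |F (τ s x) - F x| < ε := by
    refine isCompact_univ.eventually_forall_of_forall_eventually fun x _ => ?_
    refine ((hc.comp continuous_swap).tendsto (0, x)).eventually_lt_const ?_
    simpa [τ.map_zero] using hε
  obtain ⟨δ, hδ, H⟩ := Metric.eventually_nhds_iff.1 h
  refine ⟨δ / 2, by positivity, fun s hs x => (H ?_ x trivial).le⟩
  rw [Real.dist_eq, sub_zero, abs_of_nonneg hs.1]
  linarith [hs.2]

/-- Averaging an observable along the images of the orbits of `φ` under the rapidly oscillating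
shear `x ↦ T (M * re (w x ^ q)) x` amounts to averaging it along `φ` and `T`. -/
theorem exists_shear_avg (φ T : PeriodicFlow X) (hcomm : ∀ s t x, T s (φ t x) = φ t (T s x))
    (w : C(X, ℂ)) (hφ : ∀ t x, w (φ t x) = Complex.exp (2 * Real.pi * t * Complex.I) * w x)
    (h0 : ∀ s x, w x = 0 → T s x = φ s x) (F : C(X, ℝ)) {ε : ℝ} (hε : 0 < ε) {N : ℕ}
    (hN : 0 < N) :
    ∃ (q : ℕ) (M : ℝ), 0 < q ∧ N ∣ q ∧ ∀ x,
      |(∫ t in (0 : ℝ)..1, F (T (M * (w (φ t x) ^ q).re) (φ t x))) - T.avg (φ.avg F) x| ≤ ε := by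
  set G := φ.avg F with hG
  have hGφ : ∀ s x, G (φ s x) = G x := φ.avg_self_apply F
  -- Small `w` prevents large oscillation. But where `w = 0` the `T`-orbit is a `φ`-orbit, on which
  -- `G` is constant, so by compactness `G` varies little along `T` wherever `‖w‖ < c`.
  obtain ⟨c, hc, hcw⟩ : ∃ c > 0, ∀ x, ‖w x‖ < c → ∀ s ∈ Set.Icc (0 : ℝ) 1,
      |G (T s x) - G x| ≤ ε / 4 := by
    have hcont : Continuous fun p : X × ℝ => |G (T p.2 p.1) - G p.1| :=
      ((G.continuous.comp (T.continuous_comp (Y := X × ℝ) continuous_snd continuous_fst)).sub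
        (G.continuous.comp continuous_fst)).abs
    set K : Set (X × ℝ) := (Set.univ ×ˢ Set.Icc 0 1) ∩ {p | ε / 4 ≤ |G (T p.2 p.1) - G p.1|}
    have hK : IsCompact K := (isCompact_univ.prod isCompact_Icc).inter_right
      (isClosed_le continuous_const hcont)
    obtain ⟨c, hc, H⟩ := hK.exists_forall_le' (a := (0 : ℝ)) (f := fun p => ‖w p.1‖)
      (by fun_prop) (by
        rintro ⟨x, s⟩ ⟨-, hp⟩
        rw [norm_pos_iff]
        intro hwx
        simp only [Set.mem_ofPred_eq, h0 s x hwx, hGφ, sub_self, abs_zero] at hp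
        linarith)
    refine ⟨c, hc, fun x hx s hs => ?_⟩
    by_contra! hcon
    exact absurd (H (x, s) ⟨⟨trivial, hs⟩, hcon.le⟩) (not_le.2 hx)
  obtain ⟨δ, hδ, hFδ⟩ := φ.exists_forall_small_time F (half_pos hε)
  obtain ⟨R₀, hR₀, hR⟩ := exists_equidistribution_re_circle ‖G‖ (half_pos hε)
  obtain ⟨m, hm⟩ := exists_nat_gt (1 / δ)
  have hm0 : 0 < m := by
    have : (0 : ℝ) < m := lt_trans (by positivity) hm
    exact_mod_cast this
  set q := N * m with hq
  have hq0 : 0 < q := Nat.mul_pos hN hm0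
  have hqR : (0 : ℝ) < q := by exact_mod_cast hq0
  have hqδ : 1 / (q : ℝ) ≤ δ := by
    have : (m : ℝ) ≤ q := by exact_mod_cast Nat.le_mul_of_pos_left m hN
    rw [div_le_iff₀ hqR]
    rw [div_lt_iff₀ hδ] at hm
    nlinarith
  -- The amplitude of the phase is `M ‖w‖ ^ q`, which is at least `R₀` wherever `‖w‖ ≥ c`. The
  -- choice `1/q ≤ δ` makes one oscillation short compared with the variation of `F` along `φ`.
  refine ⟨q, R₀ / c ^ q, hq0, Dvd.intro _ rfl, fun x => ?_⟩
  set M := R₀ / c ^ q with hM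
  set Θ : ℝ → ℝ := fun s => ((M * w x ^ q : ℂ) * Complex.exp (2 * Real.pi * s * Complex.I)).re
    with hΘ
  have hΘc : Continuous Θ := by fun_prop
  have hΘp : Function.Periodic Θ 1 := by
    intro s
    simp only [hΘ]
    congr 2
    rw [show (2 * Real.pi * ((s + 1 : ℝ) : ℂ) * Complex.I : ℂ) =
      2 * Real.pi * s * Complex.I + 2 * Real.pi * Complex.I by push_cast; ring,
      Complex.exp_add, Complex.exp_two_pi_mul_I, mul_one]
  have hΘq : ∀ t, M * (w (φ t x) ^ q).re = Θ (q * t) := by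
    intro t
    rw [hφ, ← Complex.re_ofReal_mul, mul_pow, ← Complex.exp_nat_mul]
    simp only [hΘ]
    rw [← mul_assoc, mul_comm (M : ℂ), mul_assoc, mul_comm]
    congr 3
    push_cast
    ring
  -- Two-scale form: `s` is the fast time of the phase, `t` the slow time along the orbit, and the
  -- integral in question runs along `s = qt`.
  set g : ℝ → ℝ → ℝ := fun s t => F (T (Θ s) (φ t x)) with hg
  have hgc : ∀ {a b : ℝ × ℝ → ℝ}, Continuous a → Continuous b →
      Continuous fun p : ℝ × ℝ => g (a p) (b p) := fun {a b} ha hb =>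
    F.continuous.comp (T.continuous_comp (hΘc.comp ha) (φ.continuous_comp hb continuous_const))
  have hgc1 : ∀ {a b : ℝ → ℝ}, Continuous a → Continuous b →
      Continuous fun p : ℝ => g (a p) (b p) := fun {a b} ha hb =>
    F.continuous.comp (T.continuous_comp (hΘc.comp ha) (φ.continuous_comp hb continuous_const))
  have hint : ∀ {a b : ℝ × ℝ → ℝ}, Continuous a → Continuous b →
      Continuous fun s : ℝ => ∫ t in (0 : ℝ)..1, g (a (s, t)) (b (s, t)) := fun {a b} ha hb =>
    intervalIntegral.continuous_parametric_intervalIntegral_of_continuous' (hgc ha hb) _ _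
  have hgp1 : ∀ t, Function.Periodic (fun s => g s t) 1 := fun t s => by simp only [hg, hΘp s]
  have hdiag : Function.Periodic (fun t => g (q * t) t) 1 := by
    intro t
    simp only [hg]
    have h1 : φ (t + 1) x = φ t x := φ.periodic x t
    have h2 : Θ (q * (t + 1)) = Θ (q * t) := by
      rw [mul_add]
      exact hΘp.nat_mul q _
    rw [h1, h2]
  -- Shifting `t` by `s/q` does not change the integral over a period, so one may average over `s`
  -- as well.
  have hlhs : (∫ t in (0 : ℝ)..1, F (T (M * (w (φ t x) ^ q).re) (φ t x))) =
      ∫ s in (0 : ℝ)..1, ∫ t in (0 : ℝ)..1, g (q * t + s) (t + s / q) := by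
    have : ∀ s : ℝ, ∫ t in (0 : ℝ)..1, g (q * t + s) (t + s / q) =
        ∫ t in (0 : ℝ)..1, g (q * t) t := by
      intro s
      have e : ∀ t : ℝ, g (q * t + s) (t + s / q) = g (q * (t + s / q)) (t + s / q) := by
        intro t
        congr 1
        field_simp
      simp only [e]
      rw [intervalIntegral.integral_comp_add_right (fun t => g (q * t) t), zero_add, add_comm,
        hdiag.intervalIntegral_add_eq _ 0, zero_add]
    simp only [hΘq]
    rw [intervalIntegral.integral_congr (fun s _ => this s)]
    simp [hg]
  -- With the slow time frozen, integrating first in `s` removes the shift `qt` by periodicity; fast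
  -- and slow times then decouple.
  have hmid : (∫ s in (0 : ℝ)..1, ∫ t in (0 : ℝ)..1, g (q * t + s) t) =
      ∫ s in (0 : ℝ)..1, G (T (Θ s) x) := by
    have e1 : ∀ s, G (T (Θ s) x) = ∫ t in (0 : ℝ)..1, g s t := by
      intro s
      simp only [hG, avg_apply, hg, hcomm]
    simp only [e1]
    rw [integral_integral_swap_of_continuous (f := fun s t => g (q * t + s) t)
        (hgc (a := fun p => q * p.2 + p.1) (b := fun p => p.2) (by fun_prop) (by fun_prop)),
      integral_integral_swap_of_continuous (f := fun s t => g s t)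
        (hgc continuous_fst continuous_snd)]
    refine intervalIntegral.integral_congr fun t _ => ?_
    rw [intervalIntegral.integral_comp_add_left (fun s => g s t), add_zero,
      (hgp1 t).intervalIntegral_add_eq _ 0, zero_add]
  have hstep1 : |(∫ t in (0 : ℝ)..1, F (T (M * (w (φ t x) ^ q).re) (φ t x))) -
      ∫ s in (0 : ℝ)..1, G (T (Θ s) x)| ≤ ε / 2 := by
    rw [hlhs, ← hmid]
    refine abs_integral_sub_integral_le
      (hint (a := fun p => q * p.2 + p.1) (b := fun p => p.2 + p.1 / q) (by fun_prop) (by fun_prop))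
      (hint (a := fun p => q * p.2 + p.1) (b := fun p => p.2) (by fun_prop) (by fun_prop)) ?_
    intro s hs
    refine abs_integral_sub_integral_le (hgc1 (by fun_prop) (by fun_prop))
      (hgc1 (by fun_prop) (by fun_prop)) ?_
    intro t _
    simp only [hg]
    rw [add_comm t, φ.map_add, hcomm]
    refine hFδ _ ⟨div_nonneg hs.1 hqR.le, ?_⟩ _
    exact (div_le_div_of_nonneg_right hs.2 hqR.le).trans hqδ
  have hGc : Continuous fun s => G (T (Θ s) x) := (T.continuous_orbit G x).comp hΘc
  have hstep2 : |(∫ s in (0 : ℝ)..1, G (T (Θ s) x)) - T.avg G x| ≤ ε / 2 := by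
    rcases lt_or_ge ‖w x‖ c with hlt | hge
    · refine abs_integral_sub_integral_le hGc (T.continuous_orbit G x) fun s hs => ?_
      have h1 := hcw x hlt s hs
      obtain ⟨y, hy, hxy⟩ := (T.periodic_orbit G x).exists_mem_Ico₀ one_pos (Θ s)
      have h2 := hcw x hlt y ⟨hy.1, hy.2.le⟩
      have hxy : G (T (Θ s) x) = G (T y x) := hxy
      rw [hxy]
      rw [abs_le] at h1 h2 ⊢
      constructor <;> linarith [h1.1, h1.2, h2.1, h2.2]
    · refine hR (fun s => G (T s x)) _ (T.continuous_orbit G x) (T.periodic_orbit G x)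
        (fun s => G.norm_coe_le_norm _) ?_
      rw [norm_mul, norm_pow, Complex.norm_real, Real.norm_of_nonneg (by positivity), hM,
        div_mul_eq_mul_div, le_div_iff₀ (by positivity)]
      gcongr
  calc _ ≤ ε / 2 + ε / 2 := (abs_sub_le _ _ _).trans (add_le_add hstep1 hstep2)
    _ = ε := by ring

theorem continuous_avg (τ : PeriodicFlow X) : Continuous τ.avg := by
  refine LipschitzWith.continuous (K := 1) (LipschitzWith.of_dist_le_mul fun F G => ?_)
  rw [NNReal.coe_one, one_mul, ContinuousMap.dist_le dist_nonneg]
  exact fun x => τ.abs_avg_sub_avg_le (fun y => (Real.dist_eq _ _).symm.le.trans (ContinuousMap.dist_apply_le_dist y)) x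

/-- The iterated averages of `F` share its modulus of continuity because the flows act by
isometries, so they are precompact. An element of least sup norm in their closure must be constant:
otherwise transitivity and finitely many further averages would lower its maximum. -/
theorem exists_avgList_near_const {ι : Type*} (φ : PeriodicFlow X) (T : ι → PeriodicFlow X)
    (hcomm : ∀ u s t x, T u s (φ t x) = φ t (T u s x)) (hiso : ∀ u s, Isometry (T u s))
    (htrans : ∀ x y, ∃ u s, ∀ G : C(X, ℝ), (∀ t z, G (φ t z) = G z) → G (T u s x) = G y)
    (F : C(X, ℝ)) (hF : ∀ t x, F (φ t x) = F x) {ε : ℝ} (hε : 0 < ε) :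
    ∃ (L : List ι) (c : ℝ), ∀ x, |avgList T L F x - c| ≤ ε := by
  -- For nonnegative functions the sup norm is the maximum, and averaging commutes with adding
  -- constants.
  wlog hF0 : ∀ x, 0 ≤ F x generalizing F
  · obtain ⟨L, c, h⟩ := this (F + ContinuousMap.const X ‖F‖) (fun t x => by simp [hF])
      (fun x => by
        have := (abs_le.1 (F.norm_coe_le_norm x)).1
        simp only [ContinuousMap.add_apply, ContinuousMap.const_apply]
        linarith)
    refine ⟨L, c - ‖F‖, fun x => ?_⟩
    have := h x
    rw [avgList_add_const, ContinuousMap.add_apply, ContinuousMap.const_apply] at this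
    rwa [sub_sub_eq_add_sub]
  -- The last condition says that every modulus of continuity of `F` is one of `G`; it gives
  -- equicontinuity and is preserved by averaging.
  set A : Set C(X, ℝ) := {G | (∀ x, 0 ≤ G x) ∧ (∀ x, G x ≤ ‖F‖) ∧ (∀ t x, G (φ t x) = G x) ∧
    ∀ e δ, (∀ x y, dist x y < δ → |F x - F y| ≤ e) → ∀ x y, dist x y < δ → |G x - G y| ≤ e} with hA
  have hev : ∀ x, Continuous fun G : C(X, ℝ) => G x := fun x => continuous_eval_const x
  have hAcl : IsClosed A := by
    simp only [hA, Set.ofPred_and, Set.ofPred_forall]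
    refine IsClosed.inter ?_ (IsClosed.inter ?_ (IsClosed.inter ?_ ?_))
    · exact isClosed_iInter fun x => isClosed_le continuous_const (hev x)
    · exact isClosed_iInter fun x => isClosed_le (hev x) continuous_const
    · exact isClosed_iInter fun t => isClosed_iInter fun x => isClosed_eq (hev _) (hev _)
    · exact isClosed_iInter fun e => isClosed_iInter fun δ => isClosed_iInter fun _ =>
        isClosed_iInter fun x => isClosed_iInter fun y => isClosed_iInter fun _ =>
          isClosed_le ((hev x).sub (hev y)).abs continuous_const
  have hAc : IsCompact A := by
    set e := (ContinuousMap.isometryEquivBoundedOfCompact X ℝ).toHomeomorph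
    rw [← e.isCompact_image]
    refine BoundedContinuousFunction.arzela_ascoli₂ (Set.Icc 0 ‖F‖) isCompact_Icc _
      (e.isClosed_image.2 hAcl) ?_ ?_
    · rintro _ x ⟨G, hG, rfl⟩
      exact ⟨hG.1 x, hG.2.1 x⟩
    · intro x₀
      rw [Metric.equicontinuousAt_iff]
      intro ε' hε'
      obtain ⟨δ, hδ, hFδ⟩ := Metric.uniformContinuous_iff.1
        (CompactSpace.uniformContinuous_of_continuous F.continuous) (ε' / 2) (half_pos hε')
      refine ⟨δ, hδ, ?_⟩
      rintro x hx ⟨_, G, hG, rfl⟩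
      have := hG.2.2.2 (ε' / 2) δ (fun a b hab => (hFδ hab).le) x₀ x (by rwa [dist_comm])
      exact lt_of_le_of_lt this (half_lt_self hε')
  have hAT : ∀ u, ∀ G ∈ A, (T u).avg G ∈ A := by
    rintro u G ⟨h1, h2, h3, h4⟩
    refine ⟨(T u).avg_nonneg h1, (T u).avg_le h2, (T u).avg_comm_apply φ (hcomm u) G h3, ?_⟩
    intro e δ hFe x y hxy
    refine abs_integral_sub_integral_le ((T u).continuous_orbit G x) ((T u).continuous_orbit G y) ?_
    intro s _
    refine h4 e δ hFe _ _ ?_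
    rwa [(hiso u s).dist_eq]
  set S : Set C(X, ℝ) := Set.range fun L => avgList T L F with hS
  have hSA : S ⊆ A := by
    rintro _ ⟨L, rfl⟩
    induction L with
    | nil => exact ⟨hF0, fun x => (le_abs_self _).trans (F.norm_coe_le_norm x), hF, fun _ _ h => h⟩
    | cons u L ih => exact hAT u _ ih
  have hST : ∀ L, ∀ G ∈ closure S, avgList T L G ∈ closure S := by
    intro L G hG
    induction L with
    | nil => exact hG
    | cons u L ih =>
      refine map_mem_closure (f := (T u).avg) (T u).continuous_avg ih ?_
      rintro _ ⟨L', rfl⟩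
      exact ⟨u :: L', rfl⟩
  have hcA : closure S ⊆ A := closure_minimal hSA hAcl
  have hcc : IsCompact (closure S) := hAc.of_isClosed_subset isClosed_closure hcA
  obtain ⟨G, hG, hGmin⟩ := hcc.exists_isMinOn (f := fun G : C(X, ℝ) => ‖G‖)
    ⟨F, subset_closure ⟨[], rfl⟩⟩ continuous_norm.continuousOn
  have hGle : ∀ x, G x ≤ ‖G‖ := fun x => (le_abs_self _).trans (G.norm_coe_le_norm x)
  have hGA := hcA hG
  have hconst : ∀ y, G y = ‖G‖ := by
    by_contra! hne
    obtain ⟨y, hy⟩ := hne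
    have hy : G y < ‖G‖ := lt_of_le_of_ne (hGle y) hy
    have hpos : 0 < ‖G‖ := (hGA.1 y).trans_lt hy
    have hopen : ∀ u, IsOpen {x | ∃ s, G (T u s x) < ‖G‖} := by
      intro u
      rw [Set.ofPred_exists]
      exact isOpen_iUnion fun s => isOpen_lt
        (G.continuous.comp ((T u).continuous_comp continuous_const continuous_id)) continuous_const
    -- By transitivity every point is carried below the maximum by some flow; finitely many flows
    -- suffice for all points.
    obtain ⟨t, ht⟩ := isCompact_univ.elim_finite_subcover _ hopen (by
      intro x _
      obtain ⟨u, s, h⟩ := htrans x y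
      exact Set.mem_iUnion.2 ⟨u, s, by rw [h G hGA.2.2.1]; exact hy⟩)
    -- Averaging never raises the maximum, and a point once below it stays below under later
    -- averages, so the order of the list is irrelevant.
    have key : ∀ L : List ι, (∀ x, avgList T L G x ≤ ‖G‖) ∧
        (∀ x, G x < ‖G‖ → avgList T L G x < ‖G‖) ∧
        ∀ x, (∃ u ∈ L, ∃ s, G (T u s x) < ‖G‖) → avgList T L G x < ‖G‖ := by
      intro L
      induction L with
      | nil => exact ⟨hGle, fun _ h => h, by simp⟩
      | cons u L ih =>
        obtain ⟨i1, i2, i3⟩ := ih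
        refine ⟨(T u).avg_le i1, fun x hx => ?_, ?_⟩
        · exact (T u).avg_lt i1 (s := 0) (by rw [(T u).map_zero]; exact i2 x hx)
        · rintro x ⟨v, hv, s, hs⟩
          rcases List.mem_cons.1 hv with rfl | hv
          · exact (T v).avg_lt i1 (i2 _ hs)
          · exact (T u).avg_lt i1 (s := 0) (by
              rw [(T u).map_zero]; exact i3 x ⟨v, hv, s, hs⟩)
    have hlt : ‖avgList T t.toList G‖ < ‖G‖ := by
      rw [ContinuousMap.norm_lt_iff _ hpos]
      intro x
      have h0 := (hcA (hST t.toList G hG)).1 x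
      rw [Real.norm_of_nonneg h0]
      refine (key t.toList).2.2 x ?_
      have := ht (Set.mem_univ x)
      simp only [Set.mem_iUnion] at this
      obtain ⟨u, hu, s, hs⟩ := this
      exact ⟨u, Finset.mem_toList.2 hu, s, hs⟩
    exact absurd (hGmin (hST t.toList G hG)) (not_le.2 hlt)
  obtain ⟨_, ⟨L, rfl⟩, hL⟩ := Metric.mem_closure_iff.1 hG ε hε
  refine ⟨L, ‖G‖, fun x => ?_⟩
  rw [← hconst x, ← Real.dist_eq, dist_comm]
  exact (ContinuousMap.dist_apply_le_dist x).trans hL.le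

end Compact

end PeriodicFlow

/-! ### Measure preservation for shears and isometries -/

theorem measurePreserving_of_forall_integral_comp_eq {X : Type*} [MetricSpace X]
    [MeasurableSpace X] [BorelSpace X] {μ : Measure X} [IsFiniteMeasure μ] {g : X → X}
    (hg : Continuous g) (h : ∀ F : C(X, ℝ), ∫ x, F (g x) ∂μ = ∫ x, F x ∂μ) :
    MeasurePreserving g μ μ := by
  refine ⟨hg.measurable, ?_⟩
  have : IsFiniteMeasure (μ.map g) := Measure.isFiniteMeasure_map μ g
  refine ext_of_forall_integral_eq_of_IsFiniteMeasure fun F => ?_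
  rw [integral_map hg.measurable.aemeasurable F.continuous.aestronglyMeasurable]
  exact h F.toContinuousMap

/-- Moving points along the orbits of a measure preserving flow by an invariant amount of time
preserves the measure. -/
theorem PeriodicFlow.measurePreserving_shear {X : Type*} [MetricSpace X] [CompactSpace X]
    [MeasurableSpace X] [BorelSpace X] {μ : Measure X} [IsFiniteMeasure μ] (T : PeriodicFlow X)
    (hT : ∀ s, MeasurePreserving (T s) μ μ) {ψ : X → ℝ} (hψ : Continuous ψ)
    (hψT : ∀ s x, ψ (T s x) = ψ x) : MeasurePreserving (fun x => T (ψ x) x) μ μ := by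
  refine measurePreserving_of_forall_integral_comp_eq (T.continuous_comp hψ continuous_id) ?_
  intro F
  have hc1 : Continuous fun p : ℝ × X => F (T (ψ p.2 + p.1) p.2) :=
    F.continuous.comp (T.continuous_comp (by fun_prop) continuous_snd)
  have hc2 : Continuous fun p : ℝ × X => F (T p.1 p.2) :=
    F.continuous.comp (T.continuous_comp continuous_fst continuous_snd)
  have : IsFiniteMeasure (volume.restrict (Set.uIoc (0 : ℝ) 1)) :=
    ⟨by rw [Measure.restrict_apply_univ, Set.uIoc_of_le zero_le_one]; simp⟩
  have hint : ∀ f : ℝ × X → ℝ, Continuous f → (∀ p, ‖f p‖ ≤ ‖F‖) →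
      Integrable f ((volume.restrict (Set.uIoc 0 1)).prod μ) := fun f hf hb =>
    Integrable.of_bound hf.aestronglyMeasurable ‖F‖ (Eventually.of_forall hb)
  have hshift : ∀ f : C(X, ℝ), ∀ s, ∫ x, f (T s x) ∂μ = ∫ x, f x ∂μ := by
    intro f s
    conv_rhs => rw [← (hT s).map_eq]
    rw [integral_map (hT s).measurable.aemeasurable f.continuous.aestronglyMeasurable]
  -- Invariance of `ψ` turns composition with `T s` into the addition of `s` to the shear time.
  -- Averaging over `s` then makes `ψ` disappear.
  have e1 : ∀ s, ∫ x, F (T (ψ x + s) x) ∂μ = ∫ x, F (T (ψ x) x) ∂μ := by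
    intro s
    have := hshift ⟨fun x => F (T (ψ x) x), F.continuous.comp (T.continuous_comp hψ continuous_id)⟩ s
    simpa only [ContinuousMap.coe_mk, hψT, ← T.map_add] using this
  have e2 : ∀ x, (∫ s in (0 : ℝ)..1, F (T (ψ x + s) x)) = ∫ s in (0 : ℝ)..1, F (T s x) := by
    intro x
    rw [intervalIntegral.integral_comp_add_left (fun s => F (T s x)), add_zero,
      (T.periodic_orbit F x).intervalIntegral_add_eq _ 0, zero_add]
  calc ∫ x, F (T (ψ x) x) ∂μ = ∫ s in (0 : ℝ)..1, ∫ x, F (T (ψ x + s) x) ∂μ := by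
        simp only [e1]; simp
    _ = ∫ x, (∫ s in (0 : ℝ)..1, F (T (ψ x + s) x)) ∂μ :=
        intervalIntegral_integral_swap (f := fun s x => F (T (ψ x + s) x)) (hint _ hc1 fun p => F.norm_coe_le_norm _)
    _ = ∫ x, (∫ s in (0 : ℝ)..1, F (T s x)) ∂μ := by simp only [e2]
    _ = ∫ s in (0 : ℝ)..1, ∫ x, F (T s x) ∂μ :=
        (intervalIntegral_integral_swap (f := fun s x => F (T s x)) (hint _ hc2 fun p => F.norm_coe_le_norm _)).symm
    _ = ∫ x, F x ∂μ := by simp only [hshift F]; simp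

open scoped Pointwise in
/-- Linear isometries preserve the surface measure of the sphere. -/
theorem measurePreserving_toSphere {E : Type*} [NormedAddCommGroup E] [InnerProductSpace ℝ E]
    [FiniteDimensional ℝ E] [MeasurableSpace E] [BorelSpace E] (A : E ≃ₗᵢ[ℝ] E)
    {g : Metric.sphere (0 : E) 1 → Metric.sphere (0 : E) 1} (hg : ∀ x, (g x : E) = A x) :
    MeasurePreserving g (volume : Measure E).toSphere (volume : Measure E).toSphere := by
  have hgc : Continuous g :=
    continuous_induced_rng.2 ((A.continuous.comp continuous_subtype_val).congr fun x => (hg x).symm)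
  refine ⟨hgc.measurable, Measure.ext fun s hs => ?_⟩
  rw [Measure.map_apply hgc.measurable hs, Measure.toSphere_apply' _ hs,
    Measure.toSphere_apply' _ (hgc.measurable hs)]
  congr 1
  have hm : MeasurePreserving A volume volume := A.measurePreserving
  rw [← hm.measure_preimage_equiv (f := A.toMeasurableEquiv)
    (Set.Ioo (0 : ℝ) 1 • ((↑) '' s : Set E))]
  congr 1
  ext x
  simp only [Set.mem_smul, Set.mem_image, Set.mem_preimage]
  constructor
  · rintro ⟨r, hr, _, ⟨y, hy, rfl⟩, rfl⟩
    exact ⟨r, hr, _, ⟨g y, hy, rfl⟩, by simp [hg]⟩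
  · rintro ⟨r, hr, _, ⟨y, hy, rfl⟩, h⟩
    have hy1 : A.symm (y : E) ∈ Metric.sphere (0 : E) 1 := by simp
    refine ⟨r, hr, _, ⟨⟨A.symm y, hy1⟩, ?_, rfl⟩, ?_⟩
    · have : g ⟨A.symm y, hy1⟩ = y := Subtype.ext (by simp [hg])
      simpa [this] using hy
    · apply A.injective
      rw [map_smul, A.apply_symm_apply]
      exact h

/-! ### Linear algebra of the twists, over `ℝ` and `ℂ` -/

section Linear

variable {𝕜 : Type} [RCLike 𝕜] {n : ℕ}

/-- The bilinear form `∑ i, x i * y i`. -/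
def dotForm (x : EvenSpace 𝕜 n) : EvenSpace 𝕜 n →ₗ[𝕜] 𝕜 where
  toFun y := ∑ i, x i * y i
  map_add' y z := by simp [mul_add, Finset.sum_add_distrib]
  map_smul' c y := by simp [Finset.mul_sum, mul_left_comm]

/-- The rotation by a quarter turn in all the coordinate planes. -/
def quarterTurn (𝕜 : Type) [RCLike 𝕜] (n : ℕ) : EvenSpace 𝕜 n →ₗ[𝕜] EvenSpace 𝕜 n where
  toFun x := WithLp.toLp 2 fun i => if i.2 = 0 then x (i.1, 1) else -x (i.1, 0)
  map_add' y z := by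
    ext i
    by_cases h : i.2 = 0 <;> simp [h]
    ring
  map_smul' c y := by
    ext i
    by_cases h : i.2 = 0 <;> simp [h]

theorem dotForm_apply (x y : EvenSpace 𝕜 n) : dotForm x y = ∑ i, x i * y i := rfl

theorem quarterTurn_apply (x : EvenSpace 𝕜 n) (i : Fin n × Fin 2) :
    quarterTurn 𝕜 n x i = if i.2 = 0 then x (i.1, 1) else -x (i.1, 0) := rfl

theorem dotForm_comm (x y : EvenSpace 𝕜 n) : dotForm x y = dotForm y x := by
  simp only [dotForm_apply, mul_comm]

theorem quarterTurn_quarterTurn (x : EvenSpace 𝕜 n) :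
    quarterTurn 𝕜 n (quarterTurn 𝕜 n x) = -x := by
  ext ⟨j, k⟩
  fin_cases k <;> simp [quarterTurn_apply]

theorem dotForm_quarterTurn_left (x y : EvenSpace 𝕜 n) :
    dotForm (quarterTurn 𝕜 n x) y = -dotForm x (quarterTurn 𝕜 n y) := by
  simp only [dotForm_apply, quarterTurn_apply, Fintype.sum_prod_type, Fin.sum_univ_two,
    ← Finset.sum_neg_distrib]
  refine Finset.sum_congr rfl fun j _ => ?_
  simp

theorem dotForm_quarterTurn_self (x : EvenSpace 𝕜 n) : dotForm x (quarterTurn 𝕜 n x) = 0 := by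
  simp only [dotForm_apply, quarterTurn_apply, Fintype.sum_prod_type, Fin.sum_univ_two]
  refine Finset.sum_eq_zero fun j _ => ?_
  simp
  ring

theorem planeRotation_eq (t : ℝ) (x : EvenSpace 𝕜 n) :
    planeRotation 𝕜 t x = (Real.cos (2 * Real.pi * t) : 𝕜) • x +
      (Real.sin (2 * Real.pi * t) : 𝕜) • quarterTurn 𝕜 n x := by
  ext ⟨j, k⟩
  fin_cases k
  · simp [planeRotation, quarterTurn_apply, RCLike.real_smul_eq_coe_mul]
  · simp [planeRotation, quarterTurn_apply, RCLike.real_smul_eq_coe_mul]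
    ring

/-- The component orthogonal to `u` and to its quarter turn, for a unit vector `u`. -/
def perpPart (u : EvenSpace 𝕜 n) : EvenSpace 𝕜 n →ₗ[𝕜] EvenSpace 𝕜 n :=
  LinearMap.id - (dotForm u).smulRight u -
    (dotForm (quarterTurn 𝕜 n u)).smulRight (quarterTurn 𝕜 n u)

/-- The map which fixes `u` and its quarter turn and acts as `c + s J` on the complement, where `J`
is the quarter turn. -/
def twist (u : EvenSpace 𝕜 n) (c s : 𝕜) : EvenSpace 𝕜 n →ₗ[𝕜] EvenSpace 𝕜 n :=
  LinearMap.id + (c - 1) • perpPart u + s • (quarterTurn 𝕜 n ∘ₗ perpPart u)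

theorem perpPart_apply (u x : EvenSpace 𝕜 n) : perpPart u x =
    x - dotForm u x • u - dotForm (quarterTurn 𝕜 n u) x • quarterTurn 𝕜 n u := rfl

theorem twist_apply (u x : EvenSpace 𝕜 n) (c s : 𝕜) : twist u c s x =
    x + (c - 1) • perpPart u x + s • quarterTurn 𝕜 n (perpPart u x) := rfl

theorem perpPart_quarterTurn (u x : EvenSpace 𝕜 n) :
    perpPart u (quarterTurn 𝕜 n x) = quarterTurn 𝕜 n (perpPart u x) := by
  have h : dotForm u (quarterTurn 𝕜 n x) = -dotForm (quarterTurn 𝕜 n u) x := by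
    rw [dotForm_quarterTurn_left, neg_neg]
  simp only [perpPart_apply, map_sub, map_smul, quarterTurn_quarterTurn,
    dotForm_quarterTurn_left u (quarterTurn 𝕜 n x), h, map_neg, neg_neg]
  module

theorem dotForm_perpPart {u : EvenSpace 𝕜 n} (hu : dotForm u u = 1) (x : EvenSpace 𝕜 n) :
    dotForm u (perpPart u x) = 0 := by
  simp [perpPart_apply, hu, dotForm_quarterTurn_self]

theorem dotForm_quarterTurn_perpPart {u : EvenSpace 𝕜 n} (hu : dotForm u u = 1)
    (x : EvenSpace 𝕜 n) : dotForm (quarterTurn 𝕜 n u) (perpPart u x) = 0 := by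
  rw [dotForm_quarterTurn_left, ← perpPart_quarterTurn, dotForm_perpPart hu, neg_zero]

theorem perpPart_perpPart {u : EvenSpace 𝕜 n} (hu : dotForm u u = 1) (x : EvenSpace 𝕜 n) :
    perpPart u (perpPart u x) = perpPart u x := by
  rw [perpPart_apply u (perpPart u x), dotForm_perpPart hu, dotForm_quarterTurn_perpPart hu]
  simp

theorem dotForm_twist {u : EvenSpace 𝕜 n} (hu : dotForm u u = 1) (c s : 𝕜) (x : EvenSpace 𝕜 n) :
    dotForm u (twist u c s x) = dotForm u x := by
  have h : dotForm u (quarterTurn 𝕜 n (perpPart u x)) = 0 := by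
    rw [← perpPart_quarterTurn, dotForm_perpPart hu]
  simp [twist_apply, dotForm_perpPart hu, h]

theorem dotForm_quarterTurn_twist {u : EvenSpace 𝕜 n} (hu : dotForm u u = 1) (c s : 𝕜)
    (x : EvenSpace 𝕜 n) :
    dotForm (quarterTurn 𝕜 n u) (twist u c s x) = dotForm (quarterTurn 𝕜 n u) x := by
  have h : dotForm (quarterTurn 𝕜 n u) (quarterTurn 𝕜 n (perpPart u x)) = 0 := by
    rw [← perpPart_quarterTurn, dotForm_quarterTurn_perpPart hu]
  simp [twist_apply, dotForm_quarterTurn_perpPart hu, h]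

theorem perpPart_twist {u : EvenSpace 𝕜 n} (hu : dotForm u u = 1) (c s : 𝕜) (x : EvenSpace 𝕜 n) :
    perpPart u (twist u c s x) = c • perpPart u x + s • quarterTurn 𝕜 n (perpPart u x) := by
  simp only [twist_apply, map_add, map_smul, perpPart_quarterTurn, perpPart_perpPart hu]
  module

/-- `perpPart u` is a projection commuting with the quarter turn `J`, and `J² = -1`, so the
operators `c + sJ` multiply like complex numbers. For complex `c`, `s` this gives the inverse of the
entire shear. -/
theorem twist_twist {u : EvenSpace 𝕜 n} (hu : dotForm u u = 1) (c s c' s' : 𝕜)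
    (x : EvenSpace 𝕜 n) :
    twist u c s (twist u c' s' x) = twist u (c * c' - s * s') (s * c' + c * s') x := by
  rw [twist_apply u (twist u c' s' x), perpPart_twist hu, twist_apply, twist_apply]
  simp only [map_add, map_smul, quarterTurn_quarterTurn]
  module

theorem twist_one_zero (u x : EvenSpace 𝕜 n) : twist u 1 0 x = x := by simp [twist_apply]

theorem twist_quarterTurn (u : EvenSpace 𝕜 n) (c s : 𝕜) (x : EvenSpace 𝕜 n) :
    twist u c s (quarterTurn 𝕜 n x) = quarterTurn 𝕜 n (twist u c s x) := by
  simp only [twist_apply, perpPart_quarterTurn, map_add, map_smul]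

theorem twist_planeRotation (u : EvenSpace 𝕜 n) (c s : 𝕜) (t : ℝ) (x : EvenSpace 𝕜 n) :
    twist u c s (planeRotation 𝕜 t x) = planeRotation 𝕜 t (twist u c s x) := by
  simp only [planeRotation_eq, map_add, map_smul, twist_quarterTurn]

theorem twist_eq_planeRotation {u x : EvenSpace 𝕜 n} (h : dotForm u x = 0)
    (h' : dotForm (quarterTurn 𝕜 n u) x = 0) (t : ℝ) :
    twist u (Real.cos (2 * Real.pi * t) : 𝕜) (Real.sin (2 * Real.pi * t) : 𝕜) x =
      planeRotation 𝕜 t x := by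
  have : perpPart u x = x := by simp [perpPart_apply, h, h']
  rw [twist_apply, this, planeRotation_eq]
  module

theorem dotForm_planeRotation (u x : EvenSpace 𝕜 n) (t : ℝ) :
    dotForm u (planeRotation 𝕜 t x) = (Real.cos (2 * Real.pi * t) : 𝕜) * dotForm u x -
      (Real.sin (2 * Real.pi * t) : 𝕜) * dotForm (quarterTurn 𝕜 n u) x := by
  rw [planeRotation_eq, map_add, map_smul, map_smul, dotForm_quarterTurn_left]
  simp

theorem dotForm_quarterTurn_planeRotation (u x : EvenSpace 𝕜 n) (t : ℝ) :
    dotForm (quarterTurn 𝕜 n u) (planeRotation 𝕜 t x) =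
      (Real.cos (2 * Real.pi * t) : 𝕜) * dotForm (quarterTurn 𝕜 n u) x +
      (Real.sin (2 * Real.pi * t) : 𝕜) * dotForm u x := by
  rw [dotForm_planeRotation, quarterTurn_quarterTurn]
  simp only [dotForm_apply]
  simp

/-- The plane of `u` is orthogonal to `y = perpPart u x` and to its quarter turn `z`; moreover `y`
and `z` are orthogonal with equal squares, so `cy + sz` has the same square as `y`. -/
theorem dotForm_twist_self {u : EvenSpace 𝕜 n} (hu : dotForm u u = 1) {c s : 𝕜}
    (h : c ^ 2 + s ^ 2 = 1) (x : EvenSpace 𝕜 n) :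
    dotForm (twist u c s x) (twist u c s x) = dotForm x x := by
  set y := perpPart u x with hy
  set z := quarterTurn 𝕜 n y with hz
  have hadd : ∀ a b c : EvenSpace 𝕜 n, dotForm (a + b) c = dotForm a c + dotForm b c := by
    intro a b c
    rw [dotForm_comm, map_add, dotForm_comm c, dotForm_comm c]
  have hsm : ∀ (r : 𝕜) (a c : EvenSpace 𝕜 n), dotForm (r • a) c = r * dotForm a c := by
    intro r a c
    rw [dotForm_comm, map_smul, dotForm_comm c, smul_eq_mul]
  have h1 : dotForm x y = dotForm y y := by
    have : x = y + dotForm u x • u + dotForm (quarterTurn 𝕜 n u) x • quarterTurn 𝕜 n u := by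
      rw [hy, perpPart_apply]; module
    conv_lhs => rw [this]
    rw [hadd, hadd, hsm, hsm, dotForm_perpPart hu, dotForm_quarterTurn_perpPart hu]
    ring
  have h2 : dotForm y z = 0 := dotForm_quarterTurn_self y
  have h3 : dotForm x z = 0 := by
    have : x = y + dotForm u x • u + dotForm (quarterTurn 𝕜 n u) x • quarterTurn 𝕜 n u := by
      rw [hy, perpPart_apply]; module
    conv_lhs => rw [this]
    rw [hadd, hadd, hsm, hsm, h2, hz, hy, ← perpPart_quarterTurn, dotForm_perpPart hu,
      dotForm_quarterTurn_perpPart hu]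
    ring
  have h4 : dotForm z z = dotForm y y := by
    rw [hz, dotForm_quarterTurn_left, quarterTurn_quarterTurn, map_neg, neg_neg]
  have h5 := dotForm_comm y x
  have h6 := dotForm_comm z x
  have h7 := dotForm_comm z y
  rw [twist_apply]
  simp only [hadd, hsm, map_add, map_smul, smul_eq_mul, h5, h6, h7, h1, h2, h3, h4, ← hy, ← hz]
  linear_combination dotForm y y * h

theorem differentiable_dotForm (u : EvenSpace 𝕜 n) : Differentiable 𝕜 (dotForm u) :=
  (dotForm u).toContinuousLinearMap.differentiable

theorem differentiable_perpPart (u : EvenSpace 𝕜 n) : Differentiable 𝕜 (perpPart u) :=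
  (perpPart u).toContinuousLinearMap.differentiable

theorem differentiable_quarterTurn : Differentiable 𝕜 (quarterTurn 𝕜 n) :=
  (quarterTurn 𝕜 n).toContinuousLinearMap.differentiable

theorem dotForm_complexify (x y : EvenSpace ℝ n) :
    dotForm (complexify x) (complexify y) = ((dotForm x y : ℝ) : ℂ) := by
  simp [dotForm_apply, complexify]

theorem quarterTurn_complexify (x : EvenSpace ℝ n) :
    quarterTurn ℂ n (complexify x) = complexify (quarterTurn ℝ n x) := by
  ext i
  simp only [quarterTurn_apply, complexify]
  split_ifs <;> simp

theorem twist_complexify (u x : EvenSpace ℝ n) (c s : ℝ) :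
    twist (complexify u) (c : ℂ) (s : ℂ) (complexify x) = complexify (twist u c s x) := by
  simp only [twist_apply, perpPart_apply, quarterTurn_complexify, dotForm_complexify, map_sub,
    map_smul]
  ext i
  simp [complexify]

theorem dotForm_real (x y : EvenSpace ℝ n) : dotForm x y = inner ℝ x y := by
  simp [dotForm_apply, PiLp.inner_apply, mul_comm]

end Linear

/-! ### Twist flows on the sphere and their transitivity -/

section Sphere

variable {n : ℕ}

theorem sphereRotation_add (s t : ℝ) (x : OddSphere n) :
    sphereRotation (s + t) x = sphereRotation s (sphereRotation t x) := by
  apply Subtype.ext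
  simp only [sphereRotation, planeRotation_eq, map_add, map_smul, quarterTurn_quarterTurn, mul_add,
    Real.cos_add, Real.sin_add]
  simp only [RCLike.ofReal_real_eq_id, id]
  module

/-- The circle action as a periodic flow. -/
def circleAction (n : ℕ) : PeriodicFlow (OddSphere n) where
  toFun := sphereRotation
  continuous_uncurry := by
    refine Continuous.subtype_mk ?_ _
    simp only [planeRotation_eq, RCLike.ofReal_real_eq_id, id]
    have := (quarterTurn ℝ n).continuous_of_finiteDimensional
    fun_prop
  map_add := sphereRotation_add
  map_one x := Subtype.ext (by simp [sphereRotation, planeRotation_eq])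

theorem dotForm_self_eq_one (u : OddSphere n) : dotForm (u : EvenSpace ℝ n) u = 1 := by
  rw [dotForm_real, real_inner_self_eq_norm_sq, norm_eq_of_mem_sphere]
  norm_num

theorem norm_twist (u : OddSphere n) {c s : ℝ} (h : c ^ 2 + s ^ 2 = 1) (x : EvenSpace ℝ n) :
    ‖twist (u : EvenSpace ℝ n) c s x‖ = ‖x‖ := by
  have := dotForm_twist_self (dotForm_self_eq_one u) h x
  rw [dotForm_real, dotForm_real, real_inner_self_eq_norm_sq, real_inner_self_eq_norm_sq] at this
  exact (sq_eq_sq₀ (norm_nonneg _) (norm_nonneg _)).1 this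

/-- The flow on the sphere which fixes `u` and its quarter turn and acts as the circle action
on their orthogonal complement. -/
def twistFlow (u : OddSphere n) : PeriodicFlow (OddSphere n) where
  toFun t x := ⟨twist (u : EvenSpace ℝ n) (Real.cos (2 * Real.pi * t)) (Real.sin (2 * Real.pi * t)) x,
    by rw [mem_sphere_zero_iff_norm, norm_twist u (Real.cos_sq_add_sin_sq _), norm_eq_of_mem_sphere]⟩
  continuous_uncurry := by
    refine Continuous.subtype_mk ?_ _
    simp only [twist_apply]
    have h1 := (quarterTurn ℝ n).continuous_of_finiteDimensional
    have h2 := (perpPart (u : EvenSpace ℝ n)).continuous_of_finiteDimensional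
    fun_prop
  map_add s t x := by
    apply Subtype.ext
    simp only [twist_twist (dotForm_self_eq_one u), mul_add, Real.cos_add, Real.sin_add]
  map_one x := Subtype.ext (by simp [twist_one_zero])

theorem coe_twistFlow (u : OddSphere n) (t : ℝ) (x : OddSphere n) :
    (twistFlow u t x : EvenSpace ℝ n) =
      twist (u : EvenSpace ℝ n) (Real.cos (2 * Real.pi * t)) (Real.sin (2 * Real.pi * t)) x := rfl

theorem coe_circleAction (t : ℝ) (x : OddSphere n) :
    (circleAction n t x : EvenSpace ℝ n) = planeRotation ℝ t x := rfl

theorem twistFlow_circleAction (u : OddSphere n) (s t : ℝ) (x : OddSphere n) :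
    twistFlow u s (circleAction n t x) = circleAction n t (twistFlow u s x) :=
  Subtype.ext (twist_planeRotation _ _ _ _ _)

/-- The linear isometry extending `twistFlow u t`. -/
def twistIsometry (u : OddSphere n) (t : ℝ) : EvenSpace ℝ n ≃ₗᵢ[ℝ] EvenSpace ℝ n :=
  LinearIsometry.toLinearIsometryEquiv
    ⟨twist (u : EvenSpace ℝ n) (Real.cos (2 * Real.pi * t)) (Real.sin (2 * Real.pi * t)),
      norm_twist u (Real.cos_sq_add_sin_sq _)⟩ rfl

theorem isometry_twistFlow (u : OddSphere n) (t : ℝ) : Isometry (twistFlow u t) :=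
  Isometry.of_dist_eq fun x y => (twistIsometry u t).isometry.dist_eq (x : EvenSpace ℝ n) y

instance : IsFiniteMeasure (sphereVolume n) :=
  inferInstanceAs (IsFiniteMeasure (volume : Measure (EvenSpace ℝ n)).toSphere)

instance : (sphereVolume n).IsOpenPosMeasure :=
  inferInstanceAs (volume : Measure (EvenSpace ℝ n)).toSphere.IsOpenPosMeasure

theorem measurePreserving_twistFlow (u : OddSphere n) (t : ℝ) :
    MeasurePreserving (twistFlow u t) (sphereVolume n) (sphereVolume n) :=
  measurePreserving_toSphere (twistIsometry u t) fun _ => rfl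

theorem measurePreserving_sphereRotation (t : ℝ) :
    MeasurePreserving (sphereRotation (n := n) t) (sphereVolume n) (sphereVolume n) := by
  refine measurePreserving_toSphere (LinearIsometry.toLinearIsometryEquiv
    ⟨(Real.cos (2 * Real.pi * t)) • LinearMap.id + (Real.sin (2 * Real.pi * t)) • quarterTurn ℝ n,
      fun x => ?_⟩ rfl) fun x => (planeRotation_eq t (x : EvenSpace ℝ n)).trans ?_
  swap
  · rw [RCLike.ofReal_real_eq_id]
    rfl
  rw [← norm_planeRotation t x, planeRotation_eq]
  rfl

/-- The complex coordinate along the plane spanned by `u` and its quarter turn. -/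
def planeCoord (u : OddSphere n) : C(OddSphere n, ℂ) where
  toFun x := ((dotForm (u : EvenSpace ℝ n) x : ℝ) : ℂ) +
    ((dotForm (quarterTurn ℝ n u) x : ℝ) : ℂ) * Complex.I
  continuous_toFun := by
    have h1 := (dotForm (u : EvenSpace ℝ n)).continuous_of_finiteDimensional
    have h2 := (dotForm (quarterTurn ℝ n u)).continuous_of_finiteDimensional
    fun_prop

theorem planeCoord_apply (u x : OddSphere n) : planeCoord u x =
    ((dotForm (u : EvenSpace ℝ n) x : ℝ) : ℂ) +
      ((dotForm (quarterTurn ℝ n u) x : ℝ) : ℂ) * Complex.I := rfl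

theorem planeCoord_circleAction (u : OddSphere n) (t : ℝ) (x : OddSphere n) :
    planeCoord u (circleAction n t x) =
      Complex.exp (2 * Real.pi * t * Complex.I) * planeCoord u x := by
  rw [show (2 * Real.pi * t * Complex.I : ℂ) = ((2 * Real.pi * t : ℝ) : ℂ) * Complex.I by
    push_cast; ring, Complex.exp_mul_I, ← Complex.ofReal_cos, ← Complex.ofReal_sin]
  simp only [planeCoord_apply, coe_circleAction, dotForm_planeRotation (u : EvenSpace ℝ n),
    dotForm_quarterTurn_planeRotation, RCLike.ofReal_real_eq_id, id]
  push_cast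
  linear_combination
    (-Complex.sin (2 * Real.pi * t) * ((dotForm (quarterTurn ℝ n u) (x : EvenSpace ℝ n) : ℝ) : ℂ)) *
      Complex.I_sq

/-- Shear phases are functions of this coordinate; its invariance makes shears invertible and volume
preserving. -/
theorem planeCoord_twistFlow (u : OddSphere n) (t : ℝ) (x : OddSphere n) :
    planeCoord u (twistFlow u t x) = planeCoord u x := by
  simp only [planeCoord_apply, coe_twistFlow, dotForm_twist (dotForm_self_eq_one u),
    dotForm_quarterTurn_twist (dotForm_self_eq_one u)]

theorem twistFlow_of_planeCoord_eq_zero (u : OddSphere n) (t : ℝ) (x : OddSphere n)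
    (h : planeCoord u x = 0) : twistFlow u t x = circleAction n t x := by
  have h1 := congrArg Complex.re h
  have h2 := congrArg Complex.im h
  simp only [planeCoord_apply, Complex.add_re, Complex.ofReal_re, Complex.re_ofReal_mul,
    Complex.I_re, mul_zero, add_zero, Complex.zero_re, Complex.add_im, Complex.ofReal_im,
    Complex.im_ofReal_mul, Complex.I_im, mul_one, zero_add, Complex.zero_im] at h1 h2
  exact Subtype.ext (twist_eq_planeRotation h1 h2 t)

/-- The twist flows and the circle action together act transitively on the sphere. -/
theorem exists_twistFlow_orbit (x y : OddSphere n) : ∃ (u : OddSphere n) (s : ℝ),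
    ∀ G : C(OddSphere n, ℝ), (∀ t z, G (circleAction n t z) = G z) →
      G (twistFlow u s x) = G y := by
  -- The target may be moved along its `φ`-orbit. The half turn changes the sign of the pairing with
  -- the quarter turn of `x`, so it vanishes at some time.
  obtain ⟨r, hr⟩ : ∃ r : ℝ,
      dotForm (quarterTurn ℝ n x) (circleAction n r y : EvenSpace ℝ n) = 0 := by
    set f : ℝ → ℝ := fun r => dotForm (quarterTurn ℝ n x) (circleAction n r y : EvenSpace ℝ n)
    have hf : Continuous f :=
      (dotForm (quarterTurn ℝ n x)).continuous_of_finiteDimensional.comp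
        (continuous_subtype_val.comp
          ((circleAction n).continuous_comp continuous_id continuous_const))
    have hhalf : f (1 / 2) = -f 0 := by
      simp only [f, coe_circleAction, planeRotation_eq]
      rw [show 2 * Real.pi * (1 / 2) = Real.pi by ring]
      simp
    have hmem : (0 : ℝ) ∈ Set.uIcc (f 0) (f (1 / 2)) := by
      rw [hhalf, Set.mem_uIcc]
      rcases le_total (f 0) 0 with h | h
      · exact Or.inl ⟨h, by linarith⟩
      · exact Or.inr ⟨by linarith, h⟩
    obtain ⟨r, -, hr⟩ := intermediate_value_uIcc (f := f) hf.continuousOn hmem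
    exact ⟨r, hr⟩
  set y' := circleAction n r y with hy'
  have hy'G : ∀ G : C(OddSphere n, ℝ), (∀ t z, G (circleAction n t z) = G z) → G y' = G y :=
    fun G hG => hG r y
  -- Antipodal points lie on one `φ`-orbit, and then no twist is needed.
  by_cases hxy : (x : EvenSpace ℝ n) + y' = 0
  · refine ⟨x, 0, fun G hG => ?_⟩
    rw [(twistFlow x).map_zero, ← hy'G G hG, ← hG (1 / 2) x]
    congr 1
    apply Subtype.ext
    rw [coe_circleAction, planeRotation_eq, show 2 * Real.pi * (1 / 2) = Real.pi by ring]
    simpa using (eq_neg_of_add_eq_zero_right hxy).symm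
  · have hN : 0 < ‖(x : EvenSpace ℝ n) + y'‖ := norm_pos_iff.2 hxy
    set N := ‖(x : EvenSpace ℝ n) + y'‖ with hNdef
    have hu : N⁻¹ • ((x : EvenSpace ℝ n) + y') ∈ Metric.sphere (0 : EvenSpace ℝ n) 1 := by
      rw [mem_sphere_zero_iff_norm, norm_smul, norm_inv, Real.norm_of_nonneg hN.le]
      exact inv_mul_cancel₀ hN.ne'
    -- At time `1/2` the twist is `1` on the plane of the bisector `u` and `-1` on its complement.
    -- As `x` has no component along the quarter turn of `u`, it is reflected in `u`, that is, sent
    -- to `y'`.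
    refine ⟨⟨_, hu⟩, 1 / 2, fun G hG => ?_⟩
    rw [← hy'G G hG]
    congr 1
    apply Subtype.ext
    rw [coe_twistFlow, show 2 * Real.pi * (1 / 2) = Real.pi by ring, Real.cos_pi, Real.sin_pi,
      twist_apply, perpPart_apply]
    have hadd : ∀ a b c : EvenSpace ℝ n, dotForm (a + b) c = dotForm a c + dotForm b c := by
      intro a b c
      rw [dotForm_comm, map_add, dotForm_comm c, dotForm_comm c]
    have hsm : ∀ (r : ℝ) (a c : EvenSpace ℝ n), dotForm (r • a) c = r * dotForm a c := by
      intro r a c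
      rw [dotForm_comm, map_smul, dotForm_comm c, smul_eq_mul]
    have h1 : dotForm (quarterTurn ℝ n (y' : EvenSpace ℝ n)) x = 0 := by
      rw [dotForm_quarterTurn_left, dotForm_comm, hr, neg_zero]
    have h2 : dotForm (quarterTurn ℝ n (x : EvenSpace ℝ n)) x = 0 := by
      rw [dotForm_comm, dotForm_quarterTurn_self]
    have h3 : N ^ 2 = 2 * (1 + dotForm (y' : EvenSpace ℝ n) x) := by
      rw [hNdef, ← real_inner_self_eq_norm_sq, ← dotForm_real, hadd, map_add, map_add,
        dotForm_self_eq_one, dotForm_self_eq_one, dotForm_comm (x : EvenSpace ℝ n) y']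
      ring
    simp only [map_smul, map_add, hsm, hadd, h1, h2, dotForm_self_eq_one]
    have h4 : (N⁻¹ * (1 + dotForm (y' : EvenSpace ℝ n) x)) * N⁻¹ = 1 / 2 := by
      have : 1 + dotForm (y' : EvenSpace ℝ n) x = N ^ 2 / 2 := by linarith
      rw [this]
      field_simp
    rw [smul_smul, h4]
    simp only [add_zero, mul_zero, zero_smul, sub_zero]
    module

/-! ### Entire shears and their compositions -/

/-- The polynomial `re ((a + i b) ^ q)` in the coordinates `a`, `b` along `u` and its quarter turn. -/
def complexPhase (u : OddSphere n) (q : ℕ) (M : ℝ) (z : EvenSpace ℂ n) : ℂ :=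
  M * (((dotForm (complexify u) z + dotForm (quarterTurn ℂ n (complexify u)) z * Complex.I) ^ q +
    (dotForm (complexify u) z - dotForm (quarterTurn ℂ n (complexify u)) z * Complex.I) ^ q) / 2)

theorem complexPhase_complexify (u : OddSphere n) (q : ℕ) (M : ℝ) (x : OddSphere n) :
    complexPhase u q M (complexify x) = ((M * (planeCoord u x ^ q).re : ℝ) : ℂ) := by
  rw [complexPhase, quarterTurn_complexify, dotForm_complexify, dotForm_complexify,
    Complex.ofReal_mul, Complex.re_eq_add_conj, map_pow, planeCoord_apply]
  simp [sub_eq_add_neg]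

theorem dotForm_complexify_self (u : OddSphere n) :
    dotForm (complexify (u : EvenSpace ℝ n)) (complexify u) = 1 := by
  rw [dotForm_complexify, dotForm_self_eq_one, Complex.ofReal_one]

theorem complexPhase_twist (u : OddSphere n) (q : ℕ) (M : ℝ) (c s : ℂ) (z : EvenSpace ℂ n) :
    complexPhase u q M (twist (complexify u) c s z) = complexPhase u q M z := by
  rw [complexPhase, complexPhase, dotForm_twist (dotForm_complexify_self u),
    dotForm_quarterTurn_twist (dotForm_complexify_self u)]

/-- The rotation multiplies `a ± ib` by `exp(±2πi j/N)`, whose `q`-th power is `1` because `N ∣ q`.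
-/
theorem complexPhase_planeRotation (u : OddSphere n) {q N : ℕ} (hN : 0 < N) (hq : N ∣ q) (M : ℝ)
    (j : ℤ) (z : EvenSpace ℂ n) :
    complexPhase u q M (planeRotation ℂ (j / N) z) = complexPhase u q M z := by
  obtain ⟨m, rfl⟩ := hq
  have hN0 : (N : ℂ) ≠ 0 := by exact_mod_cast hN.ne'
  set C : ℂ := ((Real.cos (2 * Real.pi * (j / N)) : ℝ) : ℂ) with hC
  set S : ℂ := ((Real.sin (2 * Real.pi * (j / N)) : ℝ) : ℂ) with hS
  set a := dotForm (complexify (u : EvenSpace ℝ n)) z with ha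
  set b := dotForm (quarterTurn ℂ n (complexify (u : EvenSpace ℝ n))) z with hb
  have e1 : C + S * Complex.I = Complex.exp (2 * Real.pi * (j / N) * Complex.I) := by
    rw [Complex.exp_mul_I, hC, hS]
    push_cast
    rfl
  have e2 : C - S * Complex.I = Complex.exp (-(2 * Real.pi * (j / N) * Complex.I)) := by
    rw [← neg_mul, Complex.exp_mul_I, Complex.cos_neg, Complex.sin_neg, hC, hS]
    push_cast
    ring
  have p1 : (C + S * Complex.I) ^ (N * m) = 1 := by
    rw [e1, ← Complex.exp_nat_mul, Complex.exp_eq_one_iff]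
    refine ⟨j * m, ?_⟩
    push_cast
    field_simp
  have p2 : (C - S * Complex.I) ^ (N * m) = 1 := by
    rw [e2, ← Complex.exp_nat_mul, Complex.exp_eq_one_iff]
    refine ⟨-(j * m), ?_⟩
    push_cast
    field_simp
  have f1 : C * a - S * b + (C * b + S * a) * Complex.I =
      (C + S * Complex.I) * (a + b * Complex.I) := by
    linear_combination (-S * b) * Complex.I_sq
  have f2 : C * a - S * b - (C * b + S * a) * Complex.I =
      (C - S * Complex.I) * (a - b * Complex.I) := by
    linear_combination (-S * b) * Complex.I_sq
  rw [complexPhase, complexPhase, dotForm_planeRotation, dotForm_quarterTurn_planeRotation]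
  change M * (((C * a - S * b + (C * b + S * a) * Complex.I) ^ (N * m) +
    (C * a - S * b - (C * b + S * a) * Complex.I) ^ (N * m)) / 2) = _
  rw [f1, f2, mul_pow, mul_pow, p1, p2, one_mul, one_mul]

/-- The map `z ↦ exp (2π ψ(z) J) z` on the complement of `u` and its quarter turn, where `ψ` is
the polynomial `complexPhase`. -/
def complexShear (u : OddSphere n) (q : ℕ) (M : ℝ) (z : EvenSpace ℂ n) : EvenSpace ℂ n :=
  twist (complexify u) (Complex.cos (2 * Real.pi * complexPhase u q M z))
    (Complex.sin (2 * Real.pi * complexPhase u q M z)) z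

theorem complexPhase_neg (u : OddSphere n) (q : ℕ) (M : ℝ) (z : EvenSpace ℂ n) :
    complexPhase u q (-M) z = -complexPhase u q M z := by
  simp [complexPhase]

theorem complexShear_neg_complexShear (u : OddSphere n) (q : ℕ) (M : ℝ) (z : EvenSpace ℂ n) :
    complexShear u q (-M) (complexShear u q M z) = z := by
  simp only [complexShear, complexPhase_twist, twist_twist (dotForm_complexify_self u),
    complexPhase_neg, mul_neg, Complex.cos_neg, Complex.sin_neg]
  have h := Complex.cos_sq_add_sin_sq (2 * Real.pi * complexPhase u q M z)
  convert twist_one_zero (complexify (u : EvenSpace ℝ n)) z using 3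
  · linear_combination h
  · ring

theorem differentiable_complexShear (u : OddSphere n) (q : ℕ) (M : ℝ) :
    Differentiable ℂ (complexShear u q M) := by
  have h1 := differentiable_dotForm (complexify (u : EvenSpace ℝ n))
  have h2 := differentiable_dotForm (quarterTurn ℂ n (complexify (u : EvenSpace ℝ n)))
  have h3 := differentiable_perpPart (complexify (u : EvenSpace ℝ n))
  have h4 : Differentiable ℂ (quarterTurn ℂ n) := differentiable_quarterTurn
  unfold complexShear
  simp only [twist_apply, complexPhase]
  fun_prop

theorem complexShear_complexify (u : OddSphere n) (q : ℕ) (M : ℝ) (x : OddSphere n) :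
    complexShear u q M (complexify x) =
      complexify (twistFlow u (M * (planeCoord u x ^ q).re) x : OddSphere n) := by
  rw [complexShear, complexPhase_complexify, coe_twistFlow, ← twist_complexify]
  push_cast
  rfl

theorem complexShear_planeRotation (u : OddSphere n) {q N : ℕ} (hN : 0 < N) (hq : N ∣ q) (M : ℝ)
    (j : ℤ) (z : EvenSpace ℂ n) :
    complexShear u q M (planeRotation ℂ (j / N) z) =
      planeRotation ℂ (j / N) (complexShear u q M z) := by
  rw [complexShear, complexPhase_planeRotation u hN hq, twist_planeRotation, complexShear]

/-- The real shear associated with `complexShear`. -/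
def shearHomeo (u : OddSphere n) (q : ℕ) (M : ℝ) : OddSphere n ≃ₜ OddSphere n where
  toFun x := twistFlow u (M * (planeCoord u x ^ q).re) x
  invFun x := twistFlow u (-M * (planeCoord u x ^ q).re) x
  left_inv x := by
    simp only [planeCoord_twistFlow, ← (twistFlow u).map_add]
    rw [← add_mul, neg_add_cancel, zero_mul, (twistFlow u).map_zero]
  right_inv x := by
    simp only [planeCoord_twistFlow, ← (twistFlow u).map_add]
    rw [← add_mul, add_neg_cancel, zero_mul, (twistFlow u).map_zero]
  continuous_toFun := (twistFlow u).continuous_comp (by fun_prop) continuous_id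
  continuous_invFun := (twistFlow u).continuous_comp (by fun_prop) continuous_id

/-- The shear as an entire diffeomorphism. -/
def shear (u : OddSphere n) (q : ℕ) (M : ℝ) : EntDiffeo n where
  toHomeo := shearHomeo u q M
  ext := complexShear u q M
  extInv := complexShear u q (-M)
  holo_ext := (differentiable_complexShear u q M).holomorphicNear _
  holo_extInv := (differentiable_complexShear u q (-M)).holomorphicNear _
  ext_apply x := complexShear_complexify u q M x
  extInv_apply x := complexShear_complexify u q (-M) x

theorem shear_volumePreserving (u : OddSphere n) (q : ℕ) (M : ℝ) :
    (shear u q M).VolumePreserving :=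
  (twistFlow u).measurePreserving_shear (measurePreserving_twistFlow u) (by fun_prop)
    fun s x => by rw [planeCoord_twistFlow]

/-- Volume preserving entire diffeomorphisms for which the extension of the inverse is a right
inverse of the extension. -/
structure IsRegularDiffeo (h : EntDiffeo n) : Prop where
  ext_extInv : ∀ z, h.ext (h.extInv z) = z
  volumePreserving : h.VolumePreserving

/-- Extensions commuting with the rotations by multiples of `1 / N`. -/
def CommutesWithRotations (N : ℕ) (h : EntDiffeo n) : Prop :=
  ∀ (j : ℤ) z, h.ext (planeRotation ℂ (j / N) z) = planeRotation ℂ (j / N) (h.ext z)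

theorem IsRegularDiffeo.comp {f g : EntDiffeo n} (hf : IsRegularDiffeo f) (hg : IsRegularDiffeo g) :
    IsRegularDiffeo (f.comp g) where
  ext_extInv z := by
    change f.ext (g.ext (g.extInv (f.extInv z))) = z
    rw [hg.ext_extInv, hf.ext_extInv]
  volumePreserving := by
    have h : MeasurePreserving (f.toHomeo ∘ g.toHomeo) (sphereVolume n) (sphereVolume n) :=
      MeasurePreserving.comp hf.volumePreserving hg.volumePreserving
    exact h

theorem CommutesWithRotations.comp {N : ℕ} {f g : EntDiffeo n} (hf : CommutesWithRotations N f)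
    (hg : CommutesWithRotations N g) : CommutesWithRotations N (f.comp g) := fun j z => by
  change f.ext (g.ext _) = _
  rw [hg, hf]
  rfl

theorem shear_isRegularDiffeo (u : OddSphere n) (q : ℕ) (M : ℝ) : IsRegularDiffeo (shear u q M) where
  ext_extInv z := by
    have := complexShear_neg_complexShear u q (-M) z
    rwa [neg_neg] at this
  volumePreserving := shear_volumePreserving u q M

theorem planeRotation_zero {𝕜 : Type} [RCLike 𝕜] (z : EvenSpace 𝕜 n) :
    planeRotation 𝕜 0 z = z := by
  simp [planeRotation_eq]

theorem circleFlow_zero_isRegularDiffeo : IsRegularDiffeo (circleFlow n 0) where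
  ext_extInv z := by
    change planeRotation ℂ 0 (planeRotation ℂ (-0) z) = z
    rw [neg_zero, planeRotation_zero, planeRotation_zero]
  volumePreserving := measurePreserving_sphereRotation 0

/-- Induction on the list: with `h` realising the averages over the tail, precompose it with a shear
adapted to the observable `F ∘ h`. The shear adds the outer `T_u`-average, which does not enlarge
the earlier error. -/
theorem exists_isRegularDiffeo_avg_near_avgList (L : List (OddSphere n)) (F : C(OddSphere n, ℝ)) {ε : ℝ}
    (hε : 0 < ε) {N : ℕ} (hN : 0 < N) : ∃ h : EntDiffeo n, IsRegularDiffeo h ∧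
      CommutesWithRotations N h ∧ ∀ x,
        |(∫ t in (0 : ℝ)..1, F (h.toHomeo (circleAction n t x))) -
          PeriodicFlow.avgList twistFlow L ((circleAction n).avg F) x| ≤ ε := by
  induction L generalizing ε with
  | nil =>
    refine ⟨circleFlow n 0, circleFlow_zero_isRegularDiffeo, fun j z => ?_, fun x => ?_⟩
    · change planeRotation ℂ 0 _ = planeRotation ℂ _ (planeRotation ℂ 0 z)
      rw [planeRotation_zero, planeRotation_zero]
    · have : ∀ y : OddSphere n, (circleFlow n 0).toHomeo y = y := fun y =>
        (circleAction n).map_zero y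
      simp only [this]
      change |(circleAction n).avg F x - (circleAction n).avg F x| ≤ ε
      rw [sub_self, abs_zero]
      exact hε.le
  | cons u L ih =>
    obtain ⟨h, hr, hc, happ⟩ := ih (half_pos hε)
    set F' : C(OddSphere n, ℝ) := ⟨fun x => F (h.toHomeo x), by fun_prop⟩ with hF'
    obtain ⟨q, M, hq, hNq, hs⟩ := PeriodicFlow.exists_shear_avg (circleAction n) (twistFlow u)
      (twistFlow_circleAction u) (planeCoord u) (planeCoord_circleAction u)
      (twistFlow_of_planeCoord_eq_zero u) F' (half_pos hε) hN
    refine ⟨EntDiffeo.comp h (shear u q M), hr.comp (shear_isRegularDiffeo u q M),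
      hc.comp fun j z => complexShear_planeRotation u hN hNq M j z, fun x => ?_⟩
    have h1 := hs x
    have h2 := (twistFlow u).abs_avg_sub_avg_le (F := (circleAction n).avg F')
      (G := PeriodicFlow.avgList twistFlow L ((circleAction n).avg F)) happ x
    calc _ ≤ ε / 2 + ε / 2 := (abs_sub_le _ _ _).trans (add_le_add h1 h2)
      _ = ε := by ring

/-- There are entire diffeomorphisms commuting with a given finite group of rotations and mapping
all the orbits of the circle action to curves along which the average of `F` is nearly the same. -/
theorem exists_isRegularDiffeo_avg_near_const (F : C(OddSphere n, ℝ)) {ε : ℝ} (hε : 0 < ε) {N : ℕ}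
    (hN : 0 < N) : ∃ h : EntDiffeo n, IsRegularDiffeo h ∧ CommutesWithRotations N h ∧ ∃ c : ℝ, ∀ x,
        |(∫ t in (0 : ℝ)..1, F (h.toHomeo (circleAction n t x))) - c| ≤ ε := by
  obtain ⟨L, c, hL⟩ := PeriodicFlow.exists_avgList_near_const (circleAction n) twistFlow
    twistFlow_circleAction isometry_twistFlow exists_twistFlow_orbit ((circleAction n).avg F)
    ((circleAction n).avg_self_apply F) (half_pos hε)
  obtain ⟨h, hr, hc, happ⟩ := exists_isRegularDiffeo_avg_near_avgList L F (half_pos hε) hN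
  refine ⟨h, hr, hc, c, fun x => ?_⟩
  calc _ ≤ ε / 2 + ε / 2 := (abs_sub_le _ _ _).trans (add_le_add (happ x) (hL x))
    _ = ε := by ring

end Sphere

/-! ### Birkhoff means, unique ergodicity and minimality -/

section Dynamics

variable {X : Type*}

/-- Average of `F` over `x, g x, …, g^(r-1) x` for `g = f^m`. -/
def birkhoffMean (f : X → X) (F : X → ℝ) (m r : ℕ) (x : X) : ℝ :=
  (∑ i ∈ Finset.range r, F (f^[m * i] x)) / r

/-- The averages of `F` along the orbits of some power of `f` are `η`-close to a constant. -/
def HasNearlyConstantMeans (f : X → X) (F : X → ℝ) (η : ℝ) : Prop :=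
  ∃ m r : ℕ, 0 < r ∧ ∃ c, ∀ x, |birkhoffMean f F m r x - c| ≤ η

theorem abs_birkhoffMean_sub_le {f g : X → X} {F G : X → ℝ} {m r : ℕ} {η : ℝ} (hr : 0 < r)
    {x : X} (h : ∀ i ∈ Finset.range r, |F (f^[m * i] x) - G (g^[m * i] x)| ≤ η) :
    |birkhoffMean f F m r x - birkhoffMean g G m r x| ≤ η := by
  have hr' : (0 : ℝ) < r := by exact_mod_cast hr
  rw [birkhoffMean, birkhoffMean, ← sub_div, ← Finset.sum_sub_distrib, abs_div, abs_of_pos hr',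
    div_le_iff₀ hr']
  calc _ ≤ ∑ i ∈ Finset.range r, |F (f^[m * i] x) - G (g^[m * i] x)| :=
        Finset.abs_sum_le_sum_abs _ _
    _ ≤ ∑ i ∈ Finset.range r, η := Finset.sum_le_sum h
    _ = η * r := by simp [mul_comm]

variable [MetricSpace X] [CompactSpace X]

theorem HasNearlyConstantMeans.of_near {f : X → X} {F G : C(X, ℝ)} {η : ℝ}
    (h : HasNearlyConstantMeans f F η) (hFG : ‖F - G‖ ≤ η) : HasNearlyConstantMeans f G (2 * η) := by
  obtain ⟨m, r, hr, c, hc⟩ := h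
  refine ⟨m, r, hr, c, fun x => ?_⟩
  have h1 : |birkhoffMean f G m r x - birkhoffMean f F m r x| ≤ η :=
    abs_birkhoffMean_sub_le hr fun i _ => by
      rw [abs_sub_comm]
      exact ((F - G).norm_coe_le_norm _).trans hFG
  calc _ ≤ η + η := (abs_sub_le _ _ _).trans (add_le_add h1 (hc x))
    _ = 2 * η := by ring

/-- Separability of `C(X, ℝ)` leaves countably many conditions, one for each stage of the
construction. -/
theorem hasNearlyConstantMeans_of_denseSeq {f : X → X}
    (h : ∀ i k : ℕ, HasNearlyConstantMeans f (TopologicalSpace.denseSeq C(X, ℝ) i)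
      (1 / ((k : ℝ) + 1))) (F : C(X, ℝ)) {η : ℝ} (hη : 0 < η) : HasNearlyConstantMeans f F η := by
  obtain ⟨k, hk⟩ := exists_nat_one_div_lt (half_pos hη)
  have hk0 : (0 : ℝ) < 1 / ((k : ℝ) + 1) := Nat.one_div_pos_of_nat
  obtain ⟨_, ⟨i, rfl⟩, hi⟩ := Metric.mem_closure_iff.1
    (TopologicalSpace.denseRange_denseSeq C(X, ℝ) F) _ hk0
  rw [dist_comm, dist_eq_norm] at hi
  obtain ⟨m, r, hr, c, hc⟩ := (h i k).of_near hi.le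
  exact ⟨m, r, hr, c, fun x => (hc x).trans (by linarith)⟩

theorem eventually_dist_iterate_lt {f : X → X} (hf : Continuous f) (k : ℕ) {η : ℝ} (hη : 0 < η) :
    ∀ᶠ δ in 𝓝[>] (0 : ℝ), ∀ g : X → X, (∀ x, dist (g x) (f x) ≤ δ) →
      ∀ x, dist (g^[k] x) (f^[k] x) < η := by
  induction k generalizing η with
  | zero => exact Eventually.of_forall fun δ g _ x => by simpa using hη
  | succ k ih =>
    obtain ⟨ρ, hρ, h⟩ := Metric.uniformContinuous_iff.1
      (CompactSpace.uniformContinuous_of_continuous hf) (η / 2) (half_pos hη)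
    filter_upwards [ih hρ, Ioo_mem_nhdsGT (half_pos hη)] with δ h1 h2 g hg x
    rw [Function.iterate_succ_apply', Function.iterate_succ_apply']
    calc _ ≤ dist (g (g^[k] x)) (f (g^[k] x)) + dist (f (g^[k] x)) (f (f^[k] x)) :=
          dist_triangle _ _ _
      _ < η / 2 + η / 2 := add_lt_add ((hg _).trans_lt h2.2) (h (h1 g hg x))
      _ = η := by ring

/-- Only finitely many iterates enter the mean, so the property is open in the uniform topology,
with a loss of a factor two. -/
theorem HasNearlyConstantMeans.eventually {f : X → X} (hf : Continuous f) {F : C(X, ℝ)} {η : ℝ}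
    (hη : 0 < η) (h : HasNearlyConstantMeans f F η) :
    ∀ᶠ δ in 𝓝[>] (0 : ℝ), ∀ g : X → X, (∀ x, dist (g x) (f x) ≤ δ) →
      HasNearlyConstantMeans g F (2 * η) := by
  obtain ⟨m, r, hr, c, hc⟩ := h
  obtain ⟨ρ, hρ, hF⟩ := Metric.uniformContinuous_iff.1
    (CompactSpace.uniformContinuous_of_continuous F.continuous) η hη
  have := (Filter.eventually_all_finset (Finset.range r)).2
    fun i _ => eventually_dist_iterate_lt hf (m * i) hρ
  filter_upwards [this] with δ hδ g hg
  refine ⟨m, r, hr, c, fun x => ?_⟩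
  have h1 : |birkhoffMean g F m r x - birkhoffMean f F m r x| ≤ η :=
    abs_birkhoffMean_sub_le hr fun i hi => (hF (hδ i hi g hg x)).le
  calc _ ≤ η + η := (abs_sub_le _ _ _).trans (add_le_add h1 (hc x))
    _ = 2 * η := by ring

variable [MeasurableSpace X] [BorelSpace X]

theorem integral_birkhoffMean {f : X → X} {μ : Measure X} [IsFiniteMeasure μ]
    (hf : Continuous f) (hμ : MeasurePreserving f μ μ) (F : C(X, ℝ)) {m r : ℕ} (hr : 0 < r) :
    ∫ x, birkhoffMean f F m r x ∂μ = ∫ x, F x ∂μ := by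
  have hr' : (r : ℝ) ≠ 0 := by exact_mod_cast hr.ne'
  simp only [birkhoffMean]
  rw [integral_div, integral_finsetSum]
  · have : ∀ k, ∫ x, F (f^[k] x) ∂μ = ∫ x, F x ∂μ := fun k => by
      conv_rhs => rw [← (hμ.iterate k).map_eq]
      rw [integral_map (hμ.iterate k).measurable.aemeasurable F.continuous.aestronglyMeasurable]
    simp only [this, Finset.sum_const, Finset.card_range, nsmul_eq_mul]
    field_simp
  · exact fun i _ => (F.continuous.comp (hf.iterate _)).integrable_of_hasCompactSupport
      (HasCompactSupport.of_compactSpace _)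

theorem abs_integral_sub_le_of_birkhoffMean {f : X → X} {μ : Measure X} [IsFiniteMeasure μ]
    (hf : Continuous f) (hμ : MeasurePreserving f μ μ) (F : C(X, ℝ)) {m r : ℕ} (hr : 0 < r)
    {c η : ℝ} (hc : ∀ x, |birkhoffMean f F m r x - c| ≤ η) :
    |∫ x, F x ∂μ - μ.real Set.univ * c| ≤ η * μ.real Set.univ := by
  have hcont : Continuous (birkhoffMean f F m r) := by
    unfold birkhoffMean
    exact (continuous_finsetSum _ fun i _ => F.continuous.comp (hf.iterate _)).div_const _
  rw [← integral_birkhoffMean hf hμ F hr (m := m)]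
  have h1 : ∫ x, (birkhoffMean f F m r x - c) ∂μ =
      ∫ x, birkhoffMean f F m r x ∂μ - μ.real Set.univ * c := by
    rw [integral_sub (hcont.integrable_of_hasCompactSupport (HasCompactSupport.of_compactSpace _))
      (integrable_const c)]
    simp
  rw [← h1]
  exact norm_integral_le_of_norm_le_const (f := fun x => birkhoffMean f F m r x - c)
    (Eventually.of_forall hc)

/-- A Birkhoff mean has the same integral as `F` for every invariant measure, so its nearly constant
value determines that integral up to `η`. -/
theorem uniquelyErgodic_of_means {f : X → X} (hf : Continuous f) {μ : Measure X}
    [IsFiniteMeasure μ] (hμ0 : μ ≠ 0) (hμ : MeasurePreserving f μ μ)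
    (h : ∀ (F : C(X, ℝ)) (η : ℝ), 0 < η → HasNearlyConstantMeans f F η) : UniquelyErgodic f := by
  have : NeZero μ := ⟨hμ0⟩
  refine ⟨(μ Set.univ)⁻¹ • μ, ⟨inferInstance, hμ.smul_measure _⟩, ?_⟩
  have key : ∀ ν₁ ν₂ : Measure X, IsProbabilityMeasure ν₁ → IsProbabilityMeasure ν₂ →
      MeasurePreserving f ν₁ ν₁ → MeasurePreserving f ν₂ ν₂ → ν₁ = ν₂ := by
    intro ν₁ ν₂ h1 h2 hf1 hf2
    refine ext_of_forall_integral_eq_of_IsFiniteMeasure fun F => ?_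
    refine eq_of_forall_dist_le fun η hη => ?_
    obtain ⟨m, r, hr, c, hc⟩ := h F.toContinuousMap (η / 2) (half_pos hη)
    have e1 := abs_integral_sub_le_of_birkhoffMean hf hf1 _ hr hc
    have e2 := abs_integral_sub_le_of_birkhoffMean hf hf2 _ hr hc
    simp only [probReal_univ, one_mul, mul_one] at e1 e2
    rw [Real.dist_eq]
    rw [abs_sub_comm] at e2
    calc _ ≤ η / 2 + η / 2 := (abs_sub_le _ c _).trans (add_le_add e1 e2)
      _ = η := by ring
  rintro ν ⟨hν, hνf⟩
  exact key _ _ hν inferInstance hνf (hμ.smul_measure _)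

/-- If an orbit missed an open set, a bump function supported there would have zero means along it.
The nearly constant value would then be close to zero, against the positive integral. -/
theorem minimalHomeo_of_means {f : X ≃ₜ X} {μ : Measure X}
    [IsFiniteMeasure μ] [μ.IsOpenPosMeasure] (hμ : MeasurePreserving f μ μ)
    (h : ∀ (F : C(X, ℝ)) (η : ℝ), 0 < η → HasNearlyConstantMeans f F η) : MinimalHomeo f := by
  intro x
  by_contra hnd
  rw [dense_iff_inter_open] at hnd
  push Not at hnd
  obtain ⟨U, hU, ⟨y, hy⟩, hUe⟩ := hnd
  obtain ⟨F, hF0, hF1, hF⟩ := exists_continuous_zero_one_of_isClosed hU.isClosed_compl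
    (isClosed_singleton (x := y)) (by simpa using hy)
  have hpow : ∀ k : ℕ, f^[k] x = (f ^ (k : ℤ)) x := by
    intro k
    rw [zpow_natCast]
    induction k with
    | zero => rfl
    | succ k ih =>
      rw [Function.iterate_succ_apply', ih, pow_succ']
      rfl
  have hzero : ∀ k : ℕ, F (f^[k] x) = 0 := by
    intro k
    refine hF0 fun hk => ?_
    have : f^[k] x ∈ U ∩ Set.range fun k : ℤ => (f ^ k) x := ⟨hk, k, (hpow k).symm⟩
    rw [hUe] at this
    exact this
  have hpos : 0 < ∫ z, F z ∂μ := F.continuous.integral_pos_of_hasCompactSupport_nonneg_nonzero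
    (HasCompactSupport.of_compactSpace _) (fun z => (hF z).1) (x := y) (by
      rw [hF1 rfl]; exact one_ne_zero)
  set I := ∫ z, F z ∂μ with hI
  set v := μ.real Set.univ with hv
  have hv0 : 0 ≤ v := measureReal_nonneg
  -- This accuracy gives `v * c ≤ I/4` and an error at most `I/4`, hence `I ≤ I/2`; the `+ 1` avoids
  -- dividing by zero.
  obtain ⟨m, r, hr, c, hc⟩ := h F (I / (4 * (v + 1))) (by positivity)
  have e1 := abs_integral_sub_le_of_birkhoffMean f.continuous hμ F hr hc
  have e2 := hc x
  have e3 : birkhoffMean f F m r x = 0 := by simp [birkhoffMean, hzero]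
  rw [e3, zero_sub, abs_neg] at e2
  rw [← hI, ← hv] at e1
  have e4 : I / (4 * (v + 1)) * v ≤ I / 4 := by
    rw [div_mul_eq_mul_div, div_le_div_iff₀ (by positivity) (by norm_num)]
    nlinarith
  have e5 : v * c ≤ I / 4 := by
    calc v * c ≤ v * |c| := mul_le_mul_of_nonneg_left (le_abs_self c) hv0
      _ ≤ v * (I / (4 * (v + 1))) := mul_le_mul_of_nonneg_left e2 hv0
      _ ≤ I / 4 := by rwa [mul_comm]
  have := (abs_le.1 e1).2
  linarith

/-- Riemann sums along a periodic flow converge uniformly. -/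
theorem PeriodicFlow.exists_riemannSum {X : Type*} [MetricSpace X] [CompactSpace X]
    (τ : PeriodicFlow X) (G : C(X, ℝ)) {ε : ℝ} (hε : 0 < ε) :
    ∀ᶠ r : ℕ in atTop, ∀ x, |(∑ i ∈ Finset.range r, G (τ (i / r) x)) / r - τ.avg G x| ≤ ε := by
  obtain ⟨δ, hδ, h⟩ := τ.exists_forall_small_time G hε
  filter_upwards [eventually_gt_atTop 0,
    tendsto_one_div_atTop_nhds_zero_nat.eventually_le_const hδ] with r hr hrδ x
  have hr' : (0 : ℝ) < r := by exact_mod_cast hr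
  have hci := fun a b => (τ.continuous_orbit G x).intervalIntegrable (μ := volume) a b
  have hsum : τ.avg G x = ∑ i ∈ Finset.range r, ∫ t in ((i : ℝ) / r)..((i + 1 : ℕ) : ℝ) / r,
      G (τ t x) := by
    rw [intervalIntegral.sum_integral_adjacent_intervals (a := fun i : ℕ => (i : ℝ) / r)
      fun k _ => hci _ _]
    simp [avg_apply, div_self hr'.ne']
  rw [hsum, Finset.sum_div, ← Finset.sum_sub_distrib]
  refine (Finset.abs_sum_le_sum_abs _ _).trans ?_
  have hterm : ∀ i ∈ Finset.range r, |G (τ (i / r) x) / r -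
      ∫ t in ((i : ℝ) / r)..((i + 1 : ℕ) : ℝ) / r, G (τ t x)| ≤ ε / r := by
    intro i _
    have hle : (i : ℝ) / r ≤ ((i + 1 : ℕ) : ℝ) / r := by gcongr; simp
    have hlen : ((i + 1 : ℕ) : ℝ) / r - (i : ℝ) / r = 1 / r := by push_cast; ring
    have e : G (τ (i / r) x) / r = ∫ t in ((i : ℝ) / r)..((i + 1 : ℕ) : ℝ) / r,
        G (τ (i / r) x) := by
      rw [intervalIntegral.integral_const, hlen, smul_eq_mul]
      ring
    rw [abs_sub_comm, e, ← intervalIntegral.integral_sub (hci _ _) (by simp)]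
    have := intervalIntegral.norm_integral_le_of_norm_le_const (a := (i : ℝ) / r)
      (b := ((i + 1 : ℕ) : ℝ) / r) (f := fun t => G (τ t x) - G (τ (i / r) x)) (C := ε) (by
        intro t ht
        rw [Set.uIoc_of_le hle] at ht
        have := h (t - i / r) ⟨by linarith [ht.1], by linarith [ht.2]⟩ (τ (i / r) x)
        rwa [← τ.map_add, sub_add_cancel] at this)
    rw [hlen, abs_of_pos (by positivity)] at this
    exact this.trans_eq (by ring)
  refine (Finset.sum_le_sum hterm).trans ?_
  simp only [Finset.sum_const, Finset.card_range, nsmul_eq_mul]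
  rw [mul_div_cancel₀ _ hr'.ne']

end Dynamics

/-! ### Holomorphic and geometric limits -/

section UniformLimits

/-- Uniform limits of holomorphic maps between complex normed spaces are holomorphic. -/
theorem differentiableOn_of_tendstoUniformlyOn {E F : Type*} [NormedAddCommGroup E]
    [NormedSpace ℂ E] [NormedAddCommGroup F] [NormedSpace ℂ F] [CompleteSpace F] {f : ℕ → E → F}
    {g : E → F} {U : Set E} (hU : IsOpen U) (hf : ∀ k, DifferentiableOn ℂ (f k) U)
    (hfg : TendstoUniformlyOn f g atTop U) : DifferentiableOn ℂ g U := by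
  intro z hz
  obtain ⟨ρ, hρ, hball⟩ := Metric.isOpen_iff.1 hU z hz
  have hρ2 : 0 < ρ / 2 := half_pos hρ
  have hsub : ∀ w ∈ Metric.ball z (ρ / 2), Metric.ball w (ρ / 2) ⊆ U := by
    intro w hw
    refine (Metric.ball_subset_ball' ?_).trans hball
    rw [Metric.mem_ball] at hw
    linarith
  -- Cauchy's estimate on balls of radius `ρ/2`: values within `ερ/8` bound the oscillation of the
  -- difference by `ερ/4`, hence its derivative by `ε/2`.
  have hcauchy : UniformCauchySeqOn (fun k => fderiv ℂ (f k)) atTop (Metric.ball z (ρ / 2)) := by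
    rw [Metric.uniformCauchySeqOn_iff]
    intro ε hε
    obtain ⟨N, hN⟩ := Metric.uniformCauchySeqOn_iff.1 hfg.uniformCauchySeqOn (ε * ρ / 8)
      (by positivity)
    refine ⟨N, fun k hk l hl w hw => ?_⟩
    have hwU : w ∈ U := hsub w hw (Metric.mem_ball_self hρ2)
    have hd : ∀ k, DifferentiableAt ℂ (f k) w := fun k =>
      (hf k).differentiableAt (hU.mem_nhds hwU)
    rw [dist_eq_norm, ← fderiv_sub (hd k) (hd l)]
    have := Complex.norm_fderiv_le_div_of_mapsTo_ball (f := f k - f l) (c := w) (R₁ := ρ / 2)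
      (R₂ := ε * ρ / 4) (((hf k).sub (hf l)).mono (hsub w hw)) (by
        intro v hv
        have h1 := hN k hk l hl v (hsub w hw hv)
        have h2 := hN k hk l hl w hwU
        rw [dist_eq_norm] at h1 h2
        rw [Metric.mem_closedBall, dist_eq_norm]
        simp only [Pi.sub_apply]
        refine (norm_sub_le _ _).trans ?_
        linarith) hρ2
    refine this.trans_lt ?_
    rw [div_lt_iff₀ hρ2]
    nlinarith [mul_pos hε hρ]
  have hlim : ∀ w ∈ Metric.ball z (ρ / 2), ∃ A, Tendsto (fun k => fderiv ℂ (f k) w) atTop (𝓝 A) :=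
    fun w hw => cauchySeq_tendsto_of_complete (hcauchy.cauchySeq hw)
  choose! A hA using hlim
  have hunif := hcauchy.tendstoUniformlyOn_of_tendsto hA
  refine (hasFDerivAt_of_tendstoUniformlyOn Metric.isOpen_ball hunif (fun k w hw => ?_)
    (fun w hw => hfg.tendsto_at ?_)
    (Metric.mem_ball_self hρ2)).differentiableAt.differentiableWithinAt
  · exact ((hf k).differentiableAt
      (hU.mem_nhds (hsub w hw (Metric.mem_ball_self hρ2)))).hasFDerivAt
  · exact hsub w hw (Metric.mem_ball_self hρ2)

/-- Subtracting `2 * δ (k + m)` is what lets the induction close. -/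
theorem dist_le_of_geometric {E : Type*} [PseudoMetricSpace E] {a : ℕ → E} {δ : ℕ → ℝ}
    (hδ : ∀ k, δ (k + 1) ≤ δ k / 2) (ha : ∀ k, dist (a (k + 1)) (a k) ≤ δ k) (k m : ℕ) :
    dist (a k) (a (k + m)) ≤ 2 * δ k - 2 * δ (k + m) := by
  induction m with
  | zero => simp
  | succ m ih =>
    have h1 := ha (k + m)
    have h2 := hδ (k + m)
    rw [dist_comm] at h1
    have h3 := dist_triangle (a k) (a (k + m)) (a (k + m + 1))
    rw [← add_assoc]
    linarith

theorem tendsto_zero_of_geometric {δ : ℕ → ℝ} (h0 : ∀ k, 0 ≤ δ k)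
    (hδ : ∀ k, δ (k + 1) ≤ δ k / 2) : Tendsto δ atTop (𝓝 0) := by
  have h : ∀ k, δ k ≤ δ 0 * (1 / 2) ^ k := by
    intro k
    induction k with
    | zero => simp
    | succ k ih =>
      have := hδ k
      rw [pow_succ]
      linarith
  refine squeeze_zero h0 h ?_
  have := (tendsto_pow_atTop_nhds_zero_of_lt_one (r := (1 / 2 : ℝ)) (by norm_num)
    (by norm_num)).const_mul (δ 0)
  simpa using this

theorem exists_limit_of_geometric {E : Type*} [MetricSpace E] [CompleteSpace E] {a : ℕ → E}
    {δ : ℕ → ℝ} (h0 : ∀ k, 0 ≤ δ k) (hδ : ∀ k, δ (k + 1) ≤ δ k / 2)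
    (ha : ∀ k, dist (a (k + 1)) (a k) ≤ δ k) :
    ∃ b, Tendsto a atTop (𝓝 b) ∧ ∀ k, dist (a k) b ≤ 2 * δ k := by
  have hb : ∀ k m, dist (a k) (a (k + m)) ≤ 2 * δ k := fun k m =>
    (dist_le_of_geometric hδ ha k m).trans (by linarith [h0 (k + m)])
  have hc : CauchySeq a := by
    refine cauchySeq_of_le_tendsto_0' (fun k => 2 * δ k) (fun k l hkl => ?_) ?_
    · obtain ⟨m, rfl⟩ := Nat.exists_eq_add_of_le hkl
      exact hb k m
    · simpa using (tendsto_zero_of_geometric h0 hδ).const_mul 2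
  obtain ⟨b, hb'⟩ := cauchySeq_tendsto_of_complete hc
  refine ⟨b, hb', fun k => ?_⟩
  have h1 : Tendsto (fun m => dist (a k) (a (k + m))) atTop (𝓝 (dist (a k) b)) :=
    tendsto_const_nhds.dist (by simpa [add_comm] using (tendsto_add_atTop_iff_nat k).2 hb')
  exact le_of_tendsto' h1 (hb k)

end UniformLimits

/-! ### The approximation by conjugation -/

section Construction

variable {n : ℕ}

theorem dist_complexify (x y : EvenSpace ℝ n) : dist (complexify x) (complexify y) = dist x y := by
  rw [EuclideanSpace.dist_eq, EuclideanSpace.dist_eq]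
  congr 1
  refine Finset.sum_congr rfl fun i _ => ?_
  congr 1
  exact Complex.isometry_ofReal.dist_eq _ _

theorem isometry_complexify : Isometry (complexify : EvenSpace ℝ n → EvenSpace ℂ n) :=
  Isometry.of_dist_eq dist_complexify

theorem norm_complexify (x : EvenSpace ℝ n) : ‖complexify x‖ = ‖x‖ := by
  have h0 : complexify (0 : EvenSpace ℝ n) = 0 := by
    ext i
    simp [complexify]
  have := dist_complexify x 0
  rwa [h0, dist_zero_right, dist_zero_right] at this

theorem complexify_mem_closedBall {R : ℝ} (hR : 1 ≤ R) (x : OddSphere n) :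
    complexify (x : EvenSpace ℝ n) ∈ Metric.closedBall (0 : EvenSpace ℂ n) R := by
  rw [mem_closedBall_zero_iff, norm_complexify, norm_eq_of_mem_sphere]
  exact hR

/-- The extensions of `f` and `g` and those of their inverses are `δ`-close on `K`. -/
def HolClose {L M : Set (EvenSpace ℂ n)} (K : Set (EvenSpace ℂ n)) (δ : ℝ) (f : HolDiffeo n L)
    (g : HolDiffeo n M) : Prop :=
  ∀ z ∈ K, dist (f.ext z) (g.ext z) ≤ δ ∧ dist (f.extInv z) (g.extInv z) ≤ δ

namespace HolClose

variable {K L M N : Set (EvenSpace ℂ n)} {δ δ' : ℝ} {f : HolDiffeo n L} {g : HolDiffeo n M}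
  {h : HolDiffeo n N}

theorem symm (hfg : HolClose K δ f g) : HolClose K δ g f := fun z hz => by
  rw [dist_comm, dist_comm (g.extInv z)]
  exact hfg z hz

theorem trans (hfg : HolClose K δ f g) (hgh : HolClose K δ' g h) : HolClose K (δ + δ') f h :=
  fun z hz => ⟨(dist_triangle _ _ _).trans (add_le_add (hfg z hz).1 (hgh z hz).1),
    (dist_triangle _ _ _).trans (add_le_add (hfg z hz).2 (hgh z hz).2)⟩

theorem mono {K' : Set (EvenSpace ℂ n)} (hfg : HolClose K δ f g) (hK : K' ⊆ K) :
    HolClose K' δ f g := fun z hz => hfg z (hK hz)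

theorem holDist_le (hfg : HolClose K δ f g) : holDist K f g ≤ ENNReal.ofReal δ := by
  refine max_le (iSup₂_le fun z hz => ?_) (iSup₂_le fun z hz => ?_)
  · rw [edist_dist]
    exact ENNReal.ofReal_le_ofReal (hfg z hz).1
  · rw [edist_dist]
    exact ENNReal.ofReal_le_ofReal (hfg z hz).2

theorem dist_toHomeo_le {R : ℝ} (hR : 1 ≤ R) (hfg : HolClose (Metric.closedBall 0 R) δ f g)
    (x : OddSphere n) :
    dist (f.toHomeo x) (g.toHomeo x) ≤ δ ∧ dist (f.toHomeo.symm x) (g.toHomeo.symm x) ≤ δ := by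
  have := hfg _ (complexify_mem_closedBall hR x)
  rwa [f.ext_apply, g.ext_apply, f.extInv_apply, g.extInv_apply, dist_complexify,
    dist_complexify] at this

end HolClose

/-- A sequence of entire diffeomorphisms which converges geometrically on a ball. -/
theorem exists_holDiffeo_limit {R : ℝ} (hR : 1 ≤ R) {a : ℕ → EntDiffeo n} {δ : ℕ → ℝ}
    (h0 : ∀ k, 0 ≤ δ k) (hδ : ∀ k, δ (k + 1) ≤ δ k / 2)
    (ha : ∀ k, HolClose (Metric.closedBall 0 (R + 1)) (δ k) (a (k + 1)) (a k)) :
    ∃ f : HolDiffeo n (Metric.closedBall 0 R),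
      ∀ k, HolClose (Metric.closedBall 0 R) (2 * δ k) (a k) f := by
  -- The margin in the radius provides the open neighbourhood on which the limit is holomorphic.
  have hsub : Metric.closedBall (0 : EvenSpace ℂ n) R ⊆ Metric.ball 0 (R + 1) :=
    Metric.closedBall_subset_ball (by linarith)
  have hδ0 : Tendsto (fun k => 2 * δ k) atTop (𝓝 0) := by
    simpa using (tendsto_zero_of_geometric h0 hδ).const_mul 2
  have hunif : ∀ {α β : Type} [PseudoMetricSpace β] (F : ℕ → α → β) (G : α → β) (s : Set α),
      (∀ x ∈ s, ∀ k, dist (F k x) (G x) ≤ 2 * δ k) → TendstoUniformlyOn F G atTop s := by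
    intro α β _ F G s h
    rw [Metric.tendstoUniformlyOn_iff]
    intro ε hε
    filter_upwards [hδ0.eventually_lt_const hε] with k hk x hx
    rw [dist_comm]
    exact (h x hx k).trans_lt hk
  have hext : ∀ φ : ℕ → EvenSpace ℂ n → EvenSpace ℂ n, (∀ k, Differentiable ℂ (φ k)) →
      (∀ k, ∀ z ∈ Metric.closedBall 0 (R + 1), dist (φ (k + 1) z) (φ k z) ≤ δ k) →
      ∃ Φ : EvenSpace ℂ n → EvenSpace ℂ n, HolomorphicNear Φ (Metric.closedBall 0 R) ∧
        ∀ z ∈ Metric.closedBall 0 (R + 1), Tendsto (fun k => φ k z) atTop (𝓝 (Φ z)) ∧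
          ∀ k, dist (φ k z) (Φ z) ≤ 2 * δ k := by
    intro φ hφ h
    have := fun z hz => exists_limit_of_geometric (a := fun k => φ k z) h0 hδ fun k => h k z hz
    choose! Φ hΦ using this
    refine ⟨Φ, ⟨Metric.ball 0 (R + 1), Metric.isOpen_ball, hsub, ?_⟩, hΦ⟩
    exact differentiableOn_of_tendstoUniformlyOn Metric.isOpen_ball
      (fun k => (hφ k).differentiableOn)
      (hunif _ _ _ fun z hz => (hΦ z (Metric.ball_subset_closedBall hz)).2)
  have hsph : ∀ φ : ℕ → OddSphere n → OddSphere n, (∀ k, Continuous (φ k)) →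
      (∀ k x, dist (φ (k + 1) x) (φ k x) ≤ δ k) →
      ∃ Φ : OddSphere n → OddSphere n, Continuous Φ ∧ TendstoUniformly φ Φ atTop := by
    intro φ hφ h
    have := fun x => exists_limit_of_geometric (a := fun k => φ k x) h0 hδ fun k => h k x
    choose Φ hΦ using this
    have hu : TendstoUniformly φ Φ atTop :=
      tendstoUniformlyOn_univ.1 (hunif _ _ _ fun x _ => (hΦ x).2)
    exact ⟨Φ, hu.continuous (Frequently.of_forall hφ), hu⟩
  obtain ⟨Φ, hΦ, hΦlim⟩ := hext (fun k => (a k).ext) (fun k => (a k).holo_ext.differentiable)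
    fun k z hz => (ha k z hz).1
  obtain ⟨Ψ, hΨ, hΨlim⟩ := hext (fun k => (a k).extInv)
    (fun k => (a k).holo_extInv.differentiable) fun k z hz => (ha k z hz).2
  have hR1 : 1 ≤ R + 1 := by linarith
  obtain ⟨f, hf, hflim⟩ := hsph (fun k => (a k).toHomeo) (fun k => (a k).toHomeo.continuous)
    fun k x => ((ha k).dist_toHomeo_le hR1 x).1
  obtain ⟨g, hg, hglim⟩ := hsph (fun k => (a k).toHomeo.symm)
    (fun k => (a k).toHomeo.symm.continuous) fun k x => ((ha k).dist_toHomeo_le hR1 x).2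
  -- Uniform convergence of the inverses allows the limit to be taken in the composition.
  have hgf : ∀ x, g (f x) = x := by
    intro x
    have := hglim.tendsto_comp hg.continuousAt (hflim.tendsto_at x)
    simp only [Homeomorph.symm_apply_apply] at this
    exact tendsto_nhds_unique this tendsto_const_nhds
  have hfg : ∀ x, f (g x) = x := by
    intro x
    have := hflim.tendsto_comp hf.continuousAt (hglim.tendsto_at x)
    simp only [Homeomorph.apply_symm_apply] at this
    exact tendsto_nhds_unique this tendsto_const_nhds
  have hcc : Continuous fun x : OddSphere n => complexify (x : EvenSpace ℝ n) :=
    isometry_complexify.continuous.comp continuous_subtype_val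
  refine ⟨⟨⟨⟨f, g, hgf, hfg⟩, hf, hg⟩, Φ, Ψ, hΦ, hΨ, fun x => ?_, fun x => ?_⟩, fun k z hz => ?_⟩
  · refine tendsto_nhds_unique (hΦlim _ (complexify_mem_closedBall hR1 x)).1 ?_
    simp only [(a _).ext_apply]
    exact (hcc.tendsto _).comp (hflim.tendsto_at x)
  · refine tendsto_nhds_unique (hΨlim _ (complexify_mem_closedBall hR1 x)).1 ?_
    simp only [(a _).extInv_apply]
    exact (hcc.tendsto _).comp (hglim.tendsto_at x)
  · have hz' := Metric.ball_subset_closedBall (hsub hz)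
    exact ⟨(hΦlim z hz').2 k, (hΨlim z hz').2 k⟩

theorem volumePreserving_of_limit {R : ℝ} (hR : 1 ≤ R) {a : ℕ → EntDiffeo n}
    {f : HolDiffeo n (Metric.closedBall 0 R)} {δ : ℕ → ℝ} (hδ : Tendsto δ atTop (𝓝 0))
    (ha : ∀ k, (a k).VolumePreserving) (hf : ∀ k, HolClose (Metric.closedBall 0 R) (δ k) (a k) f) :
    f.VolumePreserving := by
  refine measurePreserving_of_forall_integral_comp_eq f.toHomeo.continuous fun F => ?_
  have hk : ∀ k, ∫ x, F ((a k).toHomeo x) ∂sphereVolume n = ∫ x, F x ∂sphereVolume n := by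
    intro k
    have h : MeasurePreserving (a k).toHomeo (sphereVolume n) (sphereVolume n) := ha k
    conv_rhs => rw [← h.map_eq]
    rw [integral_map h.measurable.aemeasurable F.continuous.aestronglyMeasurable]
  have hlim : Tendsto (fun k => ∫ x, F ((a k).toHomeo x) ∂sphereVolume n) atTop
      (𝓝 (∫ x, F (f.toHomeo x) ∂sphereVolume n)) := by
    refine tendsto_integral_of_dominated_convergence (fun _ => ‖F‖) (fun k => ?_)
      (integrable_const _) (fun k => Eventually.of_forall fun x => F.norm_coe_le_norm _)
      (Eventually.of_forall fun x => ?_)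
    · exact (F.continuous.comp (a k).toHomeo.continuous).aestronglyMeasurable
    · refine (F.continuous.tendsto _).comp ?_
      rw [tendsto_iff_dist_tendsto_zero]
      exact squeeze_zero (fun _ => dist_nonneg) (fun k => ((hf k).dist_toHomeo_le hR x).1) hδ
  simp only [hk] at hlim
  exact tendsto_nhds_unique hlim tendsto_const_nhds

/-- The conjugated circle action. -/
def conjFlow (H : EntDiffeo n) (t : ℝ) : EntDiffeo n :=
  EntDiffeo.comp (EntDiffeo.comp H (circleFlow n t)) (EntDiffeo.inv H)

theorem conjFlow_ext (H : EntDiffeo n) (t : ℝ) (z : EvenSpace ℂ n) :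
    (conjFlow H t).ext z = H.ext (planeRotation ℂ t (H.extInv z)) := rfl

theorem conjFlow_extInv (H : EntDiffeo n) (t : ℝ) (z : EvenSpace ℂ n) :
    (conjFlow H t).extInv z = H.ext (planeRotation ℂ (-t) (H.extInv z)) := rfl

theorem conjFlow_toHomeo (H : EntDiffeo n) (t : ℝ) (x : OddSphere n) :
    (conjFlow H t).toHomeo x = H.toHomeo (circleAction n t (H.toHomeo.symm x)) := rfl

theorem conjFlow_iterate (H : EntDiffeo n) (t : ℝ) (k : ℕ) (x : OddSphere n) :
    (conjFlow H t).toHomeo^[k] x = H.toHomeo (circleAction n (k * t) (H.toHomeo.symm x)) := by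
  induction k with
  | zero => simp [(circleAction n).map_zero]
  | succ k ih =>
    rw [Function.iterate_succ_apply', ih, conjFlow_toHomeo, Homeomorph.symm_apply_apply,
      ← (circleAction n).map_add]
    congr 2
    push_cast
    ring

theorem conjFlow_volumePreserving {H : EntDiffeo n} (hH : IsRegularDiffeo H) (t : ℝ) :
    (conjFlow H t).VolumePreserving := by
  have h1 : MeasurePreserving H.toHomeo.toMeasurableEquiv (sphereVolume n) (sphereVolume n) :=
    hH.volumePreserving
  have h2 := measurePreserving_sphereRotation (n := n) t
  have h3 : MeasurePreserving (fun x => H.toHomeo (sphereRotation t (H.toHomeo.symm x)))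
      (sphereVolume n) (sphereVolume n) := h1.comp (h2.comp (h1.symm _))
  exact h3

theorem continuous_planeRotation_uncurry :
    Continuous fun p : ℝ × EvenSpace ℂ n => planeRotation ℂ p.1 p.2 := by
  simp only [planeRotation_eq]
  have := (quarterTurn ℂ n).continuous_of_finiteDimensional
  have h1 : Continuous fun p : ℝ × EvenSpace ℂ n => ((Real.cos (2 * Real.pi * p.1) : ℝ) : ℂ) := by
    fun_prop
  have h2 : Continuous fun p : ℝ × EvenSpace ℂ n => ((Real.sin (2 * Real.pi * p.1) : ℝ) : ℂ) := by
    fun_prop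
  exact (h1.smul continuous_snd).add (h2.smul (this.comp continuous_snd))

theorem eventually_holClose_conjFlow (H : EntDiffeo n) {K : Set (EvenSpace ℂ n)}
    (hK : IsCompact K) (t₀ : ℝ) {δ : ℝ} (hδ : 0 < δ) :
    ∀ᶠ t in 𝓝 t₀, HolClose K δ (conjFlow H t) (conjFlow H t₀) := by
  have hc1 := H.holo_ext.differentiable.continuous
  have hc2 := H.holo_extInv.differentiable.continuous
  have hc3 : ∀ {f : ℝ × EvenSpace ℂ n → ℝ}, Continuous f →
      Continuous fun p : ℝ × EvenSpace ℂ n => H.ext (planeRotation ℂ (f p) (H.extInv p.2)) := by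
    intro f hf
    have h := continuous_planeRotation_uncurry.comp
      (f := fun p : ℝ × EvenSpace ℂ n => (f p, H.extInv p.2))
      (hf.prodMk (hc2.comp continuous_snd))
    exact hc1.comp h
  refine hK.eventually_forall_of_forall_eventually fun z _ => ?_
  have e1 := (hc3 continuous_fst).dist (hc3 (continuous_const (y := t₀)))
  have e2 := (hc3 (f := fun p => -p.1) continuous_fst.neg).dist (hc3 (continuous_const (y := -t₀)))
  have l1 := (e1.tendsto (t₀, z)).eventually_le_const (u := δ) (by simpa using hδ)
  have l2 := (e2.tendsto (t₀, z)).eventually_le_const (u := δ) (by simpa using hδ)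
  simp only [conjFlow_ext, conjFlow_extInv]
  exact l1.and l2

/-- `h` commutes past the rotation and cancels its inverse. This holds on all of `ℂ^{2n}`, as
closeness of the extensions requires. -/
theorem conjFlow_comp_ext (H : EntDiffeo n) {h : EntDiffeo n} (hr : IsRegularDiffeo h) {q : ℕ}
    (hc : CommutesWithRotations q h) (p : ℤ) (z : EvenSpace ℂ n) :
    (conjFlow (EntDiffeo.comp H h) (p / q)).ext z = (conjFlow H (p / q)).ext z := by
  change H.ext (h.ext (planeRotation ℂ (p / q) (h.extInv (H.extInv z)))) = _
  rw [hc, hr.ext_extInv]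
  rfl

theorem conjFlow_comp_extInv (H : EntDiffeo n) {h : EntDiffeo n} (hr : IsRegularDiffeo h) {q : ℕ}
    (hc : CommutesWithRotations q h) (p : ℤ) (z : EvenSpace ℂ n) :
    (conjFlow (EntDiffeo.comp H h) (p / q)).extInv z = (conjFlow H (p / q)).extInv z := by
  have := conjFlow_comp_ext H hr hc (-p) z
  rwa [Int.cast_neg, neg_div] at this

/-- The approximation by conjugation step: perturb `H ∘ φ^{p/q} ∘ H⁻¹` within the conjugates of
the circle action so as to equidistribute one more observable. -/
theorem exists_conjFlow_step {H : EntDiffeo n} (hH : IsRegularDiffeo H) (p : ℤ) {q : ℕ}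
    (hq : 0 < q) (F : C(OddSphere n, ℝ)) {η δ : ℝ} (hη : 0 < η) (hδ : 0 < δ)
    {K : Set (EvenSpace ℂ n)} (hK : IsCompact K) :
    ∃ (H' : EntDiffeo n) (p' : ℤ) (q' : ℕ), IsRegularDiffeo H' ∧ 0 < q' ∧
      HolClose K δ (conjFlow H' (p' / q')) (conjFlow H (p / q)) ∧
      HasNearlyConstantMeans (conjFlow H' (p' / q')).toHomeo F η := by
  obtain ⟨h, hr, hc, c, happ⟩ := exists_isRegularDiffeo_avg_near_const
    ⟨fun x => F (H.toHomeo x), by fun_prop⟩ (half_pos hη) hq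
  set H' := EntDiffeo.comp H h with hH'
  have hqR : (0 : ℝ) < q := by exact_mod_cast hq
  have hclose := eventually_holClose_conjFlow H' hK (p / q) hδ
  have hseq : Tendsto (fun r : ℕ => (p : ℝ) / q + 1 / q * (1 / (r : ℝ))) atTop (𝓝 (p / q)) := by
    simpa using (tendsto_one_div_atTop_nhds_zero_nat.const_mul (1 / (q : ℝ))).const_add
      ((p : ℝ) / q)
  set G : C(OddSphere n, ℝ) := ⟨fun x => F (H'.toHomeo x), by fun_prop⟩ with hG
  obtain ⟨r, hr1, hr2, hr0⟩ := ((hseq.eventually hclose).and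
    (((circleAction n).exists_riemannSum G (half_pos hη)).and (eventually_gt_atTop 0))).exists
  have hrR : (0 : ℝ) < r := by exact_mod_cast hr0
  -- `q` times the new rotation number is `p + 1/r`, so `r` steps of the `q`-th power sample a whole
  -- `φ`-orbit uniformly.
  have ht : (((p * r + 1 : ℤ) : ℝ) / ((q * r : ℕ) : ℝ)) = (p : ℝ) / q + 1 / q * (1 / (r : ℝ)) := by
    push_cast
    field_simp
  refine ⟨H', p * r + 1, q * r, hH.comp hr, Nat.mul_pos hq hr0, ?_, q, r, hr0, c, fun x => ?_⟩
  · rw [ht]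
    intro z hz
    rw [← conjFlow_comp_ext H hr hc, ← conjFlow_comp_extInv H hr hc]
    exact hr1 z hz
  · rw [ht]
    have e : ∀ i : ℕ, (conjFlow H' ((p : ℝ) / q + 1 / q * (1 / (r : ℝ)))).toHomeo^[q * i] x =
        H'.toHomeo (circleAction n (i / r) (H'.toHomeo.symm x)) := by
      intro i
      rw [conjFlow_iterate]
      congr 1
      have h1 : ((q * i : ℕ) : ℝ) * ((p : ℝ) / q + 1 / q * (1 / (r : ℝ))) =
          i / r + ((i * p : ℤ) : ℝ) * 1 := by
        push_cast
        field_simp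
        ring
      rw [h1]
      exact ((circleAction n).periodic (H'.toHomeo.symm x)).int_mul (i * p) (i / r)
    simp only [birkhoffMean, e]
    have h1 := hr2 (H'.toHomeo.symm x)
    have h2 := happ (H'.toHomeo.symm x)
    calc _ ≤ η / 2 + η / 2 := (abs_sub_le _ _ _).trans (add_le_add h1 h2)
      _ = η := by ring

/-- A stage of the construction: a conjugated rational rotation and the size of the
perturbations which are still allowed. -/
structure Stage (n : ℕ) where
  /-- the conjugacy -/
  conj : EntDiffeo n
  /-- numerator of the rotation number -/
  num : ℤ
  /-- denominator of the rotation number -/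
  den : ℕ
  /-- the allowed size of the next perturbation -/
  tol : ℝ
  conj_regular : IsRegularDiffeo conj
  den_pos : 0 < den
  tol_pos : 0 < tol

/-- The diffeomorphism of a stage. -/
def Stage.map (s : Stage n) : EntDiffeo n := conjFlow s.conj (s.num / s.den)

/-- The new tolerance is half of a radius at which the means are stable, because the limit lies
within twice the tolerance of each stage. -/
theorem Stage.exists_next (s : Stage n) (F : C(OddSphere n, ℝ)) {η : ℝ} (hη : 0 < η)
    {K : Set (EvenSpace ℂ n)} (hK : IsCompact K) :
    ∃ s' : Stage n, HolClose K s.tol s'.map s.map ∧ s'.tol ≤ s.tol / 2 ∧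
      ∀ g : OddSphere n → OddSphere n, (∀ x, dist (g x) (s'.map.toHomeo x) ≤ 2 * s'.tol) →
        HasNearlyConstantMeans g F (2 * η) := by
  obtain ⟨H', p', q', hH', hq', hclose, hmeans⟩ :=
    exists_conjFlow_step s.conj_regular s.num s.den_pos F hη s.tol_pos hK
  obtain ⟨δ, h1, h2⟩ := ((hmeans.eventually (Homeomorph.continuous _) hη).and
    (Ioo_mem_nhdsGT s.tol_pos)).exists
  exact ⟨⟨H', p', q', δ / 2, hH', hq', half_pos h2.1⟩, hclose, by
    simp only
    linarith [h2.2], fun g hg => h1 g fun x =>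
      (hg x).trans_eq (mul_div_cancel₀ δ two_ne_zero)⟩

theorem exists_initial_stage (t₀ : ℝ) {K : Set (EvenSpace ℂ n)} (hK : IsCompact K) {ε : ℝ}
    (hε : 0 < ε) : ∃ s : Stage n, s.tol = ε ∧ HolClose K ε s.map (circleFlow n t₀) := by
  have h := eventually_holClose_conjFlow (circleFlow n 0) hK t₀ hε
  obtain ⟨U, hU, hUo, hUt⟩ := eventually_nhds_iff.1 h
  obtain ⟨r, hr⟩ := Rat.denseRange_cast.exists_mem_open hUo ⟨t₀, hUt⟩
  refine ⟨⟨circleFlow n 0, r.num, r.den, ε, circleFlow_zero_isRegularDiffeo, r.den_pos, hε⟩, rfl,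
    fun z hz => ?_⟩
  have e1 : ∀ t z, (conjFlow (circleFlow n 0) t).ext z = (circleFlow n t).ext z := by
    intro t z
    change planeRotation ℂ 0 (planeRotation ℂ t (planeRotation ℂ (-0) z)) = planeRotation ℂ t z
    rw [neg_zero, planeRotation_zero, planeRotation_zero]
  have e2 : ∀ t z, (conjFlow (circleFlow n 0) t).extInv z = (circleFlow n t).extInv z := by
    intro t z
    exact e1 (-t) z
  have := hU r hr z hz
  rw [e1 t₀, e2 t₀, Rat.cast_def] at this
  exact this

end Construction

end

/-! ### The theorem -/

theorem theorem1 (n : ℕ) (hn : 1 ≤ n) (t₀ : ℝ) (ht₀ : t₀ ∈ Set.Icc (0 : ℝ) 1)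
    (ε : ℝ) (hε : 0 < ε) (Δ : ℝ) (hΔ : 0 < Δ) :
    ∃ f : HolDiffeo n (extBall n Δ),
      f.VolumePreserving ∧
      UniquelyErgodic f.toHomeo ∧
      MinimalHomeo f.toHomeo ∧
      holDist (extBall n Δ) f (circleFlow n t₀) < ENNReal.ofReal ε ∧
      ∃ (H : ℕ → EntDiffeo n) (t : ℕ → ℝ),
        (∀ k, (H k).VolumePreserving) ∧
        Tendsto
          (fun k => holDist (extBall n Δ)
            (((H k).comp (circleFlow n (t k))).comp (H k).inv) f)
          atTop (𝓝 0) := by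
  set R : ℝ := max Δ 1 with hRdef
  have hR : 1 ≤ R := le_max_right _ _
  have hK : IsCompact (Metric.closedBall (0 : EvenSpace ℂ n) (R + 1)) :=
    isCompact_closedBall _ _
  have hsub : Metric.closedBall (0 : EvenSpace ℂ n) R ⊆ Metric.closedBall 0 (R + 1) :=
    Metric.closedBall_subset_closedBall (by linarith)
  -- The total distance to `φ^{t₀}` is at most `2 * (ε/4) + ε/4 < ε`.
  obtain ⟨s₀, hs₀, hclose₀⟩ := exists_initial_stage (n := n) t₀ hK (by positivity : 0 < ε / 4)
  -- Step `k` encodes a pair: an observable of the dense sequence and an accuracy, halved because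
  -- stability costs a factor two.
  have hnext := fun (s : Stage n) (k : ℕ) => s.exists_next
    (TopologicalSpace.denseSeq C(OddSphere n, ℝ) k.unpair.1)
    (half_pos (Nat.one_div_pos_of_nat (n := k.unpair.2) (α := ℝ))) hK
  choose next hclose htol hmeans using hnext
  set S : ℕ → Stage n := fun k => Nat.rec s₀ (fun k s => next s k) k with hS
  have hS1 : ∀ k, S (k + 1) = next (S k) k := fun k => rfl
  obtain ⟨f, hf⟩ := exists_holDiffeo_limit hR (a := fun k => (S k).map) (δ := fun k => (S k).tol)
    (fun k => (S k).tol_pos.le) (fun k => htol (S k) k) fun k => hclose (S k) k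
  have htol0 : Tendsto (fun k => 2 * (S k).tol) atTop (𝓝 0) := by
    simpa using (tendsto_zero_of_geometric (δ := fun k => (S k).tol)
      (fun k => (S k).tol_pos.le) (fun k => htol (S k) k)).const_mul 2
  have hvol : f.VolumePreserving := volumePreserving_of_limit hR htol0
    (fun k => conjFlow_volumePreserving (S k).conj_regular _) hf
  have hall : ∀ (F : C(OddSphere n, ℝ)) (η : ℝ), 0 < η → HasNearlyConstantMeans f.toHomeo F η := by
    intro F η hη
    refine hasNearlyConstantMeans_of_denseSeq (fun i j => ?_) F hη
    have := hmeans (S (Nat.pair i j)) (Nat.pair i j) f.toHomeo (fun x => by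
      rw [dist_comm]
      exact ((hf (Nat.pair i j + 1)).dist_toHomeo_le hR x).1)
    rwa [Nat.unpair_pair, mul_div_cancel₀ _ two_ne_zero] at this
  have : Nonempty (Fin n) := ⟨⟨0, hn⟩⟩
  have hne : sphereVolume n ≠ 0 := Measure.toSphere_ne_zero _
  refine ⟨f, hvol, uniquelyErgodic_of_means f.toHomeo.continuous hne hvol hall,
    minimalHomeo_of_means hvol hall, ?_, fun k => (S k).conj, fun k => (S k).num / (S k).den,
    fun k => (S k).conj_regular.volumePreserving, ?_⟩
  · have h1 := ((hf 0).symm.trans (hclose₀.mono hsub)).holDist_le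
    refine h1.trans_lt ((ENNReal.ofReal_lt_ofReal_iff hε).2 ?_)
    change 2 * s₀.tol + ε / 4 < ε
    rw [hs₀]
    linarith
  · have h0 : Tendsto (fun k => ENNReal.ofReal (2 * (S k).tol)) atTop (𝓝 0) := by
      simpa using ENNReal.tendsto_ofReal htol0
    exact tendsto_of_tendsto_of_tendsto_of_le_of_le tendsto_const_nhds h0 (fun _ => zero_le)
      fun k => (hf k).holDist_le
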